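/- Let $G$ be a connected real semisimple Lie group with trivial center, realized as a closed subgroup of $GL(V)$ for a finite-dimensional real vector space $V$, and let $h\in G$ be such that $\sigma(g)=hgh^{-1}$ satisfies $\sigma^2=\mathrm{id}$ (so that $h^2=e$). Let $\hat K=\{g\in G:\sigma(g)=g\}$ and let $\mathfrak g=\mathfrak k\oplus\mathfrak p$ be the decomposition of the Lie algebra into the $(\pm1)$-eigenspaces of $X\mapsto hXh^{-1}$. Equip $G$ with the bi-invariant pseudo-Riemannian metric given by a non-degenerate symmetric $\mathrm{Ad}(G)$-invariant bilinear form on $\mathfrak g$, and $G/\hat K$ with the $G$-invariant metric given by its restriction to $\mathfrak p$. A smooth map from a Riemann surface into $G$ or $G/\hat K$ is harmonic if it is a critical point of the energy under compactly supported smooth variations. Let $\mathfrak C_h:G/\hat K\to G$, $\mathfrak C_h(g\hat K)=ghg^{-1}$, be the modified Cartan embedding, and let $G_h=\{ghg^{-1}:g\in G\}$. Let $M$ be a connected Riemann surface and $z_0\in M$. Then: 1. $\mathfrak C_h$ is a bijection of $G/\hat K$ onto $G_h$. 2. The map $\mathcal F\mapsto\mathfrak C_h\circ\mathcal F$ is a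 bijection from the set of harmonic maps $\mathcal F:M\to G/\hat K$ with $\mathcal F(z_0)=e\hat K$ onto the set of modified harmonic maps $M\to G_h$ (with base point $z_0$), that is, of the harmonic maps $\mathbb F:M\to G$ with values in $G_h$ such that $\mathbb F(z)^2=e$ for all $z\in M$ and $\mathbb F(z_0)=h$. (Its inverse is $\mathbb F\mapsto\mathfrak C_h^{-1}\circ\mathbb F$.) 3. This is compatible with associated families: let $p:\tilde M\to M$ be the (holomorphic) universal covering, $\tilde z_0\in\tilde M$ with $p(\tilde z_0)=z_0$, let $\mathcal F$ be as in 2, and let $F_\lambda:\tilde M\to G$ $(\lambda\in S^1)$ be an extended frame of $\mathcal F$, i.e. a family of smooth maps with $F_\lambda(\tilde z_0)=e$, $F_1\hat K=\mathcal F\circ p$ and $F_\lambda^{-1}dF_\lambda=\lambda^{-1}\alpha_{\mathfrak p}'+\alpha_{\mathfrak k}+\lambda\alpha_{\mathfrak p}''$, where $\alpha=F_1^{-1}dF_1=\alpha_{\mathfrak k}+\alpha_{\mathfrak p}$ and $\alpha_{\mathfrak p}',\alpha_{\mathfrak p}''$ are the $(1,0)$- and $(0,1)$-parts of $\alpha_{\mathfrak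 p}$. Then for every $\lambda\in S^1$ the map $\mathcal F_\lambda=F_\lambda\hat K:\tilde M\to G/\hat K$ is harmonic with $\mathcal F_\lambda(\tilde z_0)=e\hat K$, and $\mathfrak C_h\circ\mathcal F_\lambda=F_\lambda hF_\lambda^{-1}$ is a modified harmonic map $\tilde M\to G_h$ with base point $\tilde z_0$. -/

import Mathlib

open Set MeasureTheory
open scoped Manifold ContDiff TensorProduct

/- The commutator bracket of an associative ring. -/
attribute [local instance] LieRing.ofAssociativeRing

noncomputable section

namespace CartanHarmonic

/- `A` is the algebra `End V` of endomorphisms (matrices) of a finite-dimensional real vector space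
`V`, with any submultiplicative norm, so that `Aˣ = GL(V)`; only its structure of an algebra is
used. `G` is a subgroup of `Aˣ`. -/
variable {A : Type*} [NormedRing A] {G : Subgroup Aˣ}

/-- The endomorphism (matrix) underlying an element of the linear group `G`. -/
def mat (g : G) : A := ((g : Aˣ) : A)

@[simp] theorem mat_one : mat (1 : G) = 1 := by simp [mat]

@[simp] theorem mat_mul (a b : G) : mat (a * b) = mat a * mat b := by simp [mat]

@[simp] theorem mat_mul_inv (a : G) : mat a * mat a⁻¹ = 1 := by rw [← mat_mul]; simp

@[simp] theorem mat_inv_mul (a : G) : mat a⁻¹ * mat a = 1 := by rw [← mat_mul]; simp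

theorem mat_inv_eq (a : G) : mat a⁻¹ = Ring.inverse (mat a) := by
  simp [mat]

/-- The fixed point group `K` in `G` of the inner automorphism `g ↦ h g h⁻¹`. -/
def fixGroup (h : G) : Subgroup G :=
  (MulAut.conj h).toMonoidHom.eqLocus (MonoidHom.id G)

theorem mem_fixGroup {h g : G} : g ∈ fixGroup h ↔ h * g * h⁻¹ = g := Iff.rfl

/-- The quotient `G / K`. -/
abbrev SymSpace (h : G) : Type _ := G ⧸ fixGroup h

theorem conj_eq_conj_iff {h a b : G} : a * h * a⁻¹ = b * h * b⁻¹ ↔ a⁻¹ * b ∈ fixGroup h := by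
  rw [mem_fixGroup]
  constructor
  · intro e
    have : h = a⁻¹ * (b * h * b⁻¹) * a := by rw [← e]; group
    calc h * (a⁻¹ * b) * h⁻¹ = a⁻¹ * (b * h * b⁻¹) * a * (a⁻¹ * b) * h⁻¹ := by rw [← this]
      _ = a⁻¹ * b := by group
  · intro e
    have e' : h * (a⁻¹ * b) = a⁻¹ * b * h := by
      calc h * (a⁻¹ * b) = h * (a⁻¹ * b) * h⁻¹ * h := by group
        _ = _ := by rw [e]
    calc a * h * a⁻¹ = a * (h * (a⁻¹ * b)) * b⁻¹ := by group
      _ = a * (a⁻¹ * b * h) * b⁻¹ := by rw [e']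
      _ = b * h * b⁻¹ := by group

/-- The modified Cartan embedding `g K ↦ g h g⁻¹`. -/
def cartanEmbedding (h : G) : SymSpace h → G :=
  Quotient.lift (fun g : G => g * h * g⁻¹) (fun _ _ hab =>
    conj_eq_conj_iff.2 (QuotientGroup.leftRel_apply.1 hab))

/-- The conjugacy class `{g h g⁻¹}` of `h` in `G`. -/
def conjClass (h : G) : Set G := {x | ∃ g : G, x = g * h * g⁻¹}

variable [NormedAlgebra ℝ A]

/-- Smoothness on `U` of a map from a normed space into the matrix group `G`. -/
def SmoothOn {E : Type*} [NormedAddCommGroup E] [NormedSpace ℝ E] (F : E → G) (U : Set E) : Prop :=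
  ContDiffOn ℝ ∞ (fun w => mat (F w)) U

section smooth

variable {E : Type*} [NormedAddCommGroup E] [NormedSpace ℝ E]

theorem SmoothOn.mul {F H : E → G} {U : Set E} (hF : SmoothOn F U) (hH : SmoothOn H U) :
    SmoothOn (fun w => F w * H w) U := by
  unfold SmoothOn at *
  simp only [mat_mul]
  exact hF.mul hH

theorem SmoothOn.inv [CompleteSpace A] {F : E → G} {U : Set E} (hF : SmoothOn F U) :
    SmoothOn (fun w => (F w)⁻¹) U := by
  unfold SmoothOn at *
  simp only [mat_inv_eq]
  intro w hw
  exact (contDiffAt_ringInverse ℝ (F w : Aˣ)).comp_contDiffWithinAt w (hF w hw)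

theorem smoothOn_const (g : G) (U : Set E) : SmoothOn (fun _ : E => g) U :=
  contDiffOn_const

end smooth

/-- `X` is the velocity at the identity of a smooth curve in `G`. -/
def IsVelocity (G : Subgroup Aˣ) (X : A) : Prop :=
  ∃ γ : ℝ → G, SmoothOn γ univ ∧ γ 0 = 1 ∧ HasDerivAt (fun t => mat (γ t)) X 0

theorem IsVelocity.conj {X : A} (hX : IsVelocity G X) (g : G) :
    IsVelocity G (mat g * X * mat g⁻¹) := by
  obtain ⟨γ, h1, h2, h3⟩ := hX
  refine ⟨fun t => g * γ t * g⁻¹, ((smoothOn_const g _).mul h1).mul (smoothOn_const g⁻¹ _), ?_, ?_⟩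
  · simp [h2]
  · simp only [mat_mul]
    exact (h3.const_mul (mat g)).mul_const (mat g⁻¹)

/-- The tangent space of `G` at the identity. -/
def tangentOne (G : Subgroup Aˣ) : Submodule ℝ (A) where
  carrier := {X | IsVelocity G X}
  zero_mem' := ⟨fun _ => 1, smoothOn_const 1 _, rfl, hasDerivAt_const _ _⟩
  add_mem' := by
    rintro X Y ⟨γ, h1, h2, h3⟩ ⟨δ, k1, k2, k3⟩
    refine ⟨fun t => γ t * δ t, h1.mul k1, by simp [h2, k2], ?_⟩
    have := h3.fun_mul k3
    simpa [h2, k2] using this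
  smul_mem' := by
    rintro c X ⟨γ, h1, h2, h3⟩
    refine ⟨fun t => γ (c * t), ?_, by simp [h2], ?_⟩
    · exact ContDiffOn.comp (g := fun t => mat (γ t)) (f := fun t : ℝ => c * t) (t := univ) h1
        (contDiff_const.mul contDiff_id).contDiffOn (fun _ _ => mem_univ _)
    · have hc : HasDerivAt (fun t : ℝ => c * t) c 0 := by
        simpa using (hasDerivAt_id (0 : ℝ)).const_mul c
      have h3' : HasDerivAt (fun t => mat (γ t)) X (c * 0) := by simpa using h3
      exact h3'.scomp (0 : ℝ) hc

variable [FiniteDimensional ℝ A]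

theorem hasDerivAt_mem (S : Submodule ℝ (A)) {f : ℝ → A} {X : A}
    (hf : HasDerivAt f X 0) (hS : ∀ t, f t ∈ S) : X ∈ S := by
  have hcl : IsClosed (S : Set (A)) := S.closed_of_finiteDimensional
  refine hcl.mem_of_tendsto (hasDerivAt_iff_tendsto_slope.1 hf) (Filter.Eventually.of_forall ?_)
  intro t
  simp only [slope_def_module]
  exact S.smul_mem _ (S.sub_mem (hS _) (hS _))

/-- The Lie algebra of the matrix group `G`, with the commutator of matrices as bracket. -/
def lieAlg (G : Subgroup Aˣ) : LieSubalgebra ℝ (A) where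
  toSubmodule := tangentOne G
  lie_mem' := by
    intro X Y hX hY
    have : CompleteSpace A := FiniteDimensional.complete ℝ A
    obtain ⟨γ, h1, h2, h3⟩ := hX
    have hi : HasDerivAt (fun t => mat (γ t)⁻¹) (-X) 0 := by
      have hsm : DifferentiableAt ℝ (fun t => mat (γ t)⁻¹) 0 :=
        ((h1.inv.contDiffAt Filter.univ_mem).differentiableAt (by simp))
      have hp := h3.mul hsm.hasDerivAt
      have hq : HasDerivAt ((fun t => mat (γ t)) * fun t => mat (γ t)⁻¹) 0 0 := by
        have : ((fun t => mat (γ t)) * fun t => mat (γ t)⁻¹) = fun _ => (1 : A) := by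
          funext t; simp
        rw [this]; exact hasDerivAt_const _ _
      have he := hp.unique hq
      simp [h2] at he
      have : deriv (fun t => mat (γ t)⁻¹) 0 = -X := by
        rw [eq_neg_iff_add_eq_zero, add_comm]; exact he
      rw [← this]; exact hsm.hasDerivAt
    have hd : HasDerivAt (fun t => mat (γ t) * Y * mat (γ t)⁻¹) (X * Y - Y * X) 0 := by
      have := (h3.mul_const Y).fun_mul hi
      simpa [h2, sub_eq_add_neg] using this
    have := hasDerivAt_mem (tangentOne G) hd (fun t => IsVelocity.conj hY (γ t))
    simpa [Ring.lie_def] using this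

/-- The adjoint action of `G` on its Lie algebra. -/
def Ad (g : G) (X : lieAlg G) : lieAlg G :=
  ⟨mat g * (X : A) * mat g⁻¹, IsVelocity.conj X.2 g⟩

/-- A bi-invariant pseudo-Riemannian metric on `G`, that is, a non-degenerate symmetric bilinear
form on the Lie algebra which is invariant under the adjoint action (for semisimple `G` for example
plus or minus the Killing form). -/
structure BiinvariantMetric (G : Subgroup Aˣ) where
  form : LinearMap.BilinForm ℝ (lieAlg G)
  symm : form.IsSymm
  nondegenerate : form.Nondegenerate
  invariant : ∀ (g : G) (X Y : lieAlg G), form (Ad g X) (Ad g Y) = form X Y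

open Classical in
/-- The square `⟨X, X⟩` of an element `X` of the Lie algebra of `G`, given as a matrix. -/
def normSq (B : BiinvariantMetric G) (X : A) : ℝ :=
  if hX : X ∈ lieAlg G then B.form ⟨X, hX⟩ ⟨X, hX⟩ else 0

/-- The pulled back Maurer-Cartan form `F⁻¹ dF`, at the point `w`, evaluated on the vector `v`. -/
def maurerCartan {E : Type*} [NormedAddCommGroup E] [NormedSpace ℝ E] (F : E → G) (w v : E) :
    A :=
  mat (F w)⁻¹ * fderiv ℝ (fun x => mat (F x)) w v

/-- The Maurer-Cartan form of a smooth map takes values in the Lie algebra, so that `normSq` never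
meets its default value. -/
theorem maurerCartan_mem {E : Type*} [NormedAddCommGroup E] [NormedSpace ℝ E] {F : E → G}
    {V : Set E} (hV : IsOpen V) (hF : SmoothOn F V) {w : E} (hw : w ∈ V) (v : E) :
    maurerCartan F w v ∈ lieAlg G := by
  have hcont : Continuous (fun s : ℝ => w + s • v) := by fun_prop
  obtain ⟨ε, hε, hb⟩ := Metric.isOpen_iff.1 (hV.preimage hcont) 0 (by simpa using hw)
  set φ : ℝ → ℝ := fun t => (ε / 2) * Real.sin (t / (ε / 2)) with hφ
  have hφs : ContDiff ℝ ∞ φ := by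
    exact contDiff_const.mul (Real.contDiff_sin.comp (contDiff_id.div_const _))
  have hφd : HasDerivAt φ 1 0 := by
    have h1 : HasDerivAt (fun t : ℝ => t / (ε / 2)) (1 / (ε / 2)) 0 :=
      (hasDerivAt_id (0 : ℝ)).div_const _
    have h2 := (h1.sin).const_mul (ε / 2)
    have : ε / 2 * (Real.cos (0 / (ε / 2)) * (1 / (ε / 2))) = 1 := by
      simp [hε.ne']
    rw [this] at h2
    exact h2
  have hφV : ∀ t, w + φ t • v ∈ V := by
    intro t
    apply hb
    simp only [Metric.mem_ball, dist_zero_right, Real.norm_eq_abs, hφ, abs_mul]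
    rw [abs_of_pos (by positivity : 0 < ε / 2)]
    have := Real.abs_sin_le_one (t / (ε / 2))
    nlinarith
  have hc : ContDiff ℝ ∞ (fun t => w + φ t • v) :=
    contDiff_const.add (hφs.smul contDiff_const)
  have hcd : HasDerivAt (fun t => w + φ t • v) v 0 := by
    simpa using (hφd.smul_const v).const_add w
  have hφ0 : φ 0 = 0 := by simp [hφ]
  have hsm : SmoothOn (fun t : ℝ => F (w + φ t • v)) univ :=
    ContDiffOn.comp (g := fun x => mat (F x)) hF hc.contDiffOn (fun t _ => hφV t)
  refine ⟨fun t => (F w)⁻¹ * F (w + φ t • v), (smoothOn_const _ _).mul hsm, by simp [hφ0], ?_⟩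
  simp only [mat_mul]
  have hdF : HasFDerivAt (fun x => mat (F x)) (fderiv ℝ (fun x => mat (F x)) w) (w + φ 0 • v) := by
    have : DifferentiableAt ℝ (fun x => mat (F x)) w :=
      ((hF.contDiffAt (hV.mem_nhds hw)).differentiableAt (by simp))
    simpa [hφ0] using this.hasFDerivAt
  exact (hdF.comp_hasDerivAt (0 : ℝ) hcd).const_mul _

/-! ### The symmetric space `G / K` and its metric -/

/-- The component in `𝔨` of a Lie algebra element `X`, where `𝔤 = 𝔨 ⊕ 𝔭` is the decomposition into
the `1`- and `(-1)`-eigenspaces of the involution `X ↦ h X h⁻¹`. -/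
def kPart (h : G) (X : A) : A := (1 / 2 : ℝ) • (X + mat h * X * mat h⁻¹)

/-- The component in `𝔭` of a Lie algebra element `X`. -/
def pPart (h : G) (X : A) : A := (1 / 2 : ℝ) • (X - mat h * X * mat h⁻¹)

section quotient

variable {E : Type*} [NormedAddCommGroup E] [NormedSpace ℝ E]

/-- `F` is a smooth lift to `G`, over the set `V`, of the map `u` into `G / K`. -/
def IsLift {h : G} (u : E → SymSpace h) (F : E → G) (V : Set E) : Prop :=
  SmoothOn F V ∧ ∀ w ∈ V, u w = (F w : SymSpace h)

/-- Smoothness on the open set `U` of a map into `G / K`: since `G → G / K` is a smooth principal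
bundle, the smooth maps are those that lift locally to smooth maps into `G`. -/
def QuotSmoothOn {h : G} (u : E → SymSpace h) (U : Set E) : Prop :=
  ∀ w ∈ U, ∃ V : Set E, IsOpen V ∧ w ∈ V ∧ ∃ F : E → G, IsLift u F V

end quotient

/-! ### Energy densities and harmonic maps on open subsets of `ℂ` -/

/-- The energy density of a map from an open subset of `ℂ` into `G`. -/
def energyDensity (B : BiinvariantMetric G) (u : ℂ → G) (w : ℂ) : ℝ :=
  (1 / 2) * (normSq B (maurerCartan u w 1) + normSq B (maurerCartan u w Complex.I))

/-- The energy density of `w ↦ F w K`, where `T (G / K)` at `g K` is identified with `𝔭` by the left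
translation with `g`, and `𝔭` carries the restriction of the given form. -/
def liftEnergyDensity (B : BiinvariantMetric G) (h : G) (F : ℂ → G) (w : ℂ) : ℝ :=
  (1 / 2) * (normSq B (pPart h (maurerCartan F w 1)) +
    normSq B (pPart h (maurerCartan F w Complex.I)))

open Classical in
/-- The energy density of a map from an open subset of `ℂ` into `G / K`, for the `G`-invariant
metric induced by the given form; it is computed with any smooth local lift. -/
def quotEnergyDensity (B : BiinvariantMetric G) {h : G} (u : ℂ → SymSpace h) (w : ℂ) : ℝ :=
  if H : ∃ F : ℂ → G, ∃ V : Set ℂ, IsOpen V ∧ w ∈ V ∧ IsLift u F V then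
    liftEnergyDensity B h H.choose w
  else 0

theorem normSq_conj (B : BiinvariantMetric G) (g : G) (X : A) :
    normSq B (mat g * X * mat g⁻¹) = normSq B X := by
  have key : ∀ (a : G) (Y : A), Y ∈ lieAlg G → mat a * Y * mat a⁻¹ ∈ lieAlg G :=
    fun a Y hY => IsVelocity.conj hY a
  by_cases hX : X ∈ lieAlg G
  · have h1 := key g X hX
    simp only [normSq, hX, h1, dif_pos]
    exact B.invariant g ⟨X, hX⟩ ⟨X, hX⟩
  · have h1 : mat g * X * mat g⁻¹ ∉ lieAlg G := by
      intro h1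
      apply hX
      have h2 := key g⁻¹ _ h1
      have : mat g⁻¹ * (mat g * X * mat g⁻¹) * mat g⁻¹⁻¹ = X := by
        calc _ = (mat g⁻¹ * mat g) * X * (mat g⁻¹ * mat g⁻¹⁻¹) := by noncomm_ring
          _ = X := by simp
      rwa [this] at h2
    simp only [normSq, hX, h1, dif_neg, not_false_iff]

/-- The `𝔭`-part of the Maurer-Cartan form in terms of `F h F⁻¹`. -/
theorem pPart_maurerCartan {h : G} {F : ℂ → G} {V : Set ℂ} (hV : IsOpen V) (hF : SmoothOn F V)
    {w : ℂ} (hw : w ∈ V) (v : ℂ) :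
    pPart h (maurerCartan F w v) = (1 / 2 : ℝ) • (mat (F w)⁻¹ *
      fderiv ℝ (fun x => mat (F x * h * (F x)⁻¹)) w v * mat (F w) * mat h⁻¹) := by
  have : CompleteSpace A := FiniteDimensional.complete ℝ A
  have hx : SmoothOn (fun x => F x * h * (F x)⁻¹) V := (hF.mul (smoothOn_const h _)).mul hF.inv
  have dF : DifferentiableAt ℝ (fun x => mat (F x)) w :=
    ((hF.contDiffAt (hV.mem_nhds hw)).differentiableAt (by simp))
  have dx : DifferentiableAt ℝ (fun x => mat (F x * h * (F x)⁻¹)) w :=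
    ((hx.contDiffAt (hV.mem_nhds hw)).differentiableAt (by simp))
  have e1 : (fun x => mat (F x * h * (F x)⁻¹)) * (fun x => mat (F x)) =
      fun x => mat (F x) * mat h := by
    funext x
    simp only [Pi.mul_apply]
    rw [← mat_mul, ← mat_mul]
    congr 1
    group
  have e2 := dx.hasFDerivAt.mul' dF.hasFDerivAt
  rw [e1] at e2
  have e3 := congrArg (fun L => L v) (e2.unique (dF.hasFDerivAt.mul_const' (mat h)))
  have e3' : mat (F w * h * (F w)⁻¹) * (fderiv ℝ (fun x => mat (F x)) w) v +
      (fderiv ℝ (fun x => mat (F x * h * (F x)⁻¹)) w) v * mat (F w) =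
      (fderiv ℝ (fun x => mat (F x)) w) v * mat h := e3
  simp only [mat_mul] at e3'
  simp only [pPart, maurerCartan]
  congr 1
  set D := (fderiv ℝ (fun x => mat (F x)) w) v
  set Dx := (fderiv ℝ (fun x => mat (F x) * mat h * mat (F x)⁻¹) w) v with hDx
  have hDx' : (fderiv ℝ (fun x => mat (F x * h * (F x)⁻¹)) w) v = Dx := by
    simp [hDx]
  rw [hDx']
  have e4 : Dx * mat (F w) = D * mat h - mat (F w) * mat h * mat (F w)⁻¹ * D := by
    rw [← e3']; noncomm_ring
  have e5 : mat (F w)⁻¹ * Dx * mat (F w) * mat h⁻¹ = mat (F w)⁻¹ * (Dx * mat (F w)) * mat h⁻¹ := by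
    noncomm_ring
  rw [e5, e4]
  have e6 : mat (F w)⁻¹ * (D * mat h - mat (F w) * mat h * mat (F w)⁻¹ * D) * mat h⁻¹ =
      mat (F w)⁻¹ * D * (mat h * mat h⁻¹) -
        (mat (F w)⁻¹ * mat (F w)) * (mat h * (mat (F w)⁻¹ * D) * mat h⁻¹) := by noncomm_ring
  rw [e6]
  simp

/-- The energy density of a map into `G / K` does not depend on the lift. -/
theorem quotEnergyDensity_eq (B : BiinvariantMetric G) {h : G} {u : ℂ → SymSpace h} {F : ℂ → G}
    {V : Set ℂ} (hV : IsOpen V) (hF : IsLift u F V) {w : ℂ} (hw : w ∈ V) :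
    quotEnergyDensity B u w = liftEnergyDensity B h F w := by
  have H : ∃ F : ℂ → G, ∃ V : Set ℂ, IsOpen V ∧ w ∈ V ∧ IsLift u F V := ⟨F, V, hV, hw, hF⟩
  obtain ⟨V', hV', hw', hF'⟩ := H.choose_spec
  simp only [quotEnergyDensity, dif_pos H]
  set F' := H.choose
  have hk : ∀ x ∈ V ∩ V', (F x)⁻¹ * F' x ∈ fixGroup h := by
    intro x hx
    have := (hF.2 x hx.1).symm.trans (hF'.2 x hx.2)
    exact QuotientGroup.eq.1 this
  have hD : fderiv ℝ (fun x => mat (F' x * h * (F' x)⁻¹)) w =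
      fderiv ℝ (fun x => mat (F x * h * (F x)⁻¹)) w := by
    apply Filter.EventuallyEq.fderiv_eq
    filter_upwards [(hV.inter hV').mem_nhds ⟨hw, hw'⟩] with x hx
    rw [conj_eq_conj_iff.2 (hk x hx)]
  have main : ∀ v : ℂ, normSq B (pPart h (maurerCartan F' w v)) =
      normSq B (pPart h (maurerCartan F w v)) := by
    intro v
    rw [← normSq_conj B ((F w)⁻¹ * F' w)]
    congr 1
    rw [pPart_maurerCartan hV' hF'.1 hw', pPart_maurerCartan hV hF.1 hw, hD]
    set D := (fderiv ℝ (fun x => mat (F x * h * (F x)⁻¹)) w) v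
    have hkk : h⁻¹ * ((F w)⁻¹ * F' w)⁻¹ = ((F w)⁻¹ * F' w)⁻¹ * h⁻¹ := by
      have := mem_fixGroup.1 (hk w ⟨hw, hw'⟩)
      rw [← mul_inv_rev, ← mul_inv_rev]
      congr 1
      calc (F w)⁻¹ * F' w * h = h * ((F w)⁻¹ * F' w) * h⁻¹ * h := by rw [this]
        _ = _ := by group
    rw [mul_smul_comm, smul_mul_assoc]
    congr 1
    calc mat ((F w)⁻¹ * F' w) * (mat (F' w)⁻¹ * D * mat (F' w) * mat h⁻¹) *
          mat ((F w)⁻¹ * F' w)⁻¹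
        = mat ((F w)⁻¹ * F' w) * mat (F' w)⁻¹ * D * (mat (F' w) *
            (mat h⁻¹ * mat ((F w)⁻¹ * F' w)⁻¹)) := by noncomm_ring
      _ = mat ((F w)⁻¹ * F' w) * mat (F' w)⁻¹ * D * (mat (F' w) *
            (mat ((F w)⁻¹ * F' w)⁻¹ * mat h⁻¹)) := by
          rw [← mat_mul h⁻¹, hkk, mat_mul _ h⁻¹]
      _ = mat ((F w)⁻¹ * F' w * (F' w)⁻¹) * D * mat (F' w * ((F w)⁻¹ * F' w)⁻¹ ) * mat h⁻¹ := by
          simp only [mat_mul]; noncomm_ring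
      _ = _ := by
          congr 3
          · congr 2; group
          · group
  simp only [liftEnergyDensity, main]

/-- A map `u` from the open set `U ⊆ ℂ` into `G` is harmonic: it is smooth and a critical point of
the energy with respect to all smooth variations with compact support. -/
structure HarmonicOn (B : BiinvariantMetric G) (u : ℂ → G) (U : Set ℂ) : Prop where
  smooth : SmoothOn u U
  critical : ∀ Φ : ℝ → ℂ → G, SmoothOn (fun p : ℝ × ℂ => Φ p.1 p.2) (univ ×ˢ U) →
    (∀ w ∈ U, Φ 0 w = u w) →
    ∀ C : Set ℂ, IsCompact C → C ⊆ U → (∀ t, ∀ w ∈ U \ C, Φ t w = u w) →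
    HasDerivAt (fun t => ∫ w in C, energyDensity B (Φ t) w) 0 0

/-- A map `u` from the open set `U ⊆ ℂ` into `G / K` is harmonic: it is smooth and a critical point
of the energy with respect to all smooth variations with compact support. -/
structure QuotHarmonicOn (B : BiinvariantMetric G) {h : G} (u : ℂ → SymSpace h) (U : Set ℂ) :
    Prop where
  smooth : QuotSmoothOn u U
  critical : ∀ Φ : ℝ → ℂ → SymSpace h,
    QuotSmoothOn (fun p : ℝ × ℂ => Φ p.1 p.2) (univ ×ˢ U) →
    (∀ w ∈ U, Φ 0 w = u w) →
    ∀ C : Set ℂ, IsCompact C → C ⊆ U → (∀ t, ∀ w ∈ U \ C, Φ t w = u w) →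
    HasDerivAt (fun t => ∫ w in C, quotEnergyDensity B (Φ t) w) 0 0

/-! ### Harmonic maps on Riemann surfaces -/

section surface

variable {M : Type*} [TopologicalSpace M] [ChartedSpace ℂ M]

/-- Harmonic maps from a Riemann surface into `G`. Harmonicity is a local property, and in dimension
two the energy is conformally invariant, so that it can be tested in the holomorphic charts. -/
def IsHarmonic (B : BiinvariantMetric G) (f : M → G) : Prop :=
  ∀ e ∈ atlas ℂ M, HarmonicOn B (fun w => f (e.symm w)) e.target

/-- Harmonic maps from a Riemann surface into `G / K`. -/
def IsQuotHarmonic (B : BiinvariantMetric G) {h : G} (f : M → SymSpace h) : Prop :=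
  ∀ e ∈ atlas ℂ M, QuotHarmonicOn B (fun w => f (e.symm w)) e.target

/-- The harmonic maps into `G / K` that send the base point `z₀` to `e K`. -/
def BasedHarmonic (B : BiinvariantMetric G) (h : G) (z₀ : M) : Set (M → SymSpace h) :=
  {f | IsQuotHarmonic B f ∧ f z₀ = ((1 : G) : SymSpace h)}

/-- The modified harmonic maps: the harmonic maps into `G` with values in the conjugacy class of
`h`, with square `e`, and with value `h` at `z₀`. -/
def ModifiedHarmonic (B : BiinvariantMetric G) (h : G) (z₀ : M) : Set (M → G) :=
  {f | IsHarmonic B f ∧ (∀ z, f z ∈ conjClass h) ∧ (∀ z, f z * f z = 1) ∧ f z₀ = h}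

/-- An element of `A` as an element of the complexification `ℂ ⊗ A`. -/
def complexify (X : A) : ℂ ⊗[ℝ] A := (1 : ℂ) ⊗ₜ[ℝ] X

/-- The `(1,0)`-part (complex linear part) of a real linear form on `ℂ` with values in `A`. -/
def part10 (α : ℂ → A) (v : ℂ) : ℂ ⊗[ℝ] A :=
  (1 / 2 : ℂ) • (complexify (α v) - Complex.I • complexify (α (Complex.I * v)))

/-- The `(0,1)`-part (complex antilinear part). -/
def part01 (α : ℂ → A) (v : ℂ) : ℂ ⊗[ℝ] A :=
  (1 / 2 : ℂ) • (complexify (α v) + Complex.I • complexify (α (Complex.I * v)))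

/-- `F` is an extended frame, normalized at `z₀`, of the map `f` into `G / K`: a family of smooth
maps `F_λ` into `G`, `|λ| = 1`, such that `F_1` is a lift of `f`, `F_λ(z₀) = e`, and
`F_λ⁻¹ dF_λ = λ⁻¹ α_𝔭' + α_𝔨 + λ α_𝔭''` in every holomorphic chart, where `α = F_1⁻¹ dF_1`. -/
structure IsExtendedFrame (h : G) (z₀ : M) (f : M → SymSpace h) (F : Circle → M → G) : Prop where
  smooth : ∀ l : Circle, ∀ e ∈ atlas ℂ M, SmoothOn (fun w => F l (e.symm w)) e.target
  lift : ∀ z, f z = (F 1 z : SymSpace h)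
  base : ∀ l : Circle, F l z₀ = 1
  equation : ∀ l : Circle, ∀ e ∈ atlas ℂ M, ∀ w ∈ e.target, ∀ v : ℂ,
    complexify (maurerCartan (fun x => F l (e.symm x)) w v) =
      (l : ℂ)⁻¹ • part10 (fun v' => pPart h (maurerCartan (fun x => F 1 (e.symm x)) w v')) v
      + complexify (kPart h (maurerCartan (fun x => F 1 (e.symm x)) w v))
      + (l : ℂ) • part01 (fun v' => pPart h (maurerCartan (fun x => F 1 (e.symm x)) w v')) v

end surface

end CartanHarmonic

end

/-
Since `h² = e`, the Cartan embedding `𝒞(gK) = g h g⁻¹` satisfies, for every local lift `F` of a map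
`u` into `G / K`, the identity `(𝒞 u)⁻¹ d(𝒞 u) = -2 Ad(F) α_𝔭` with `α = F⁻¹ dF`. Hence `𝒞`
multiplies energies by `4`, and the Euler-Lagrange operator `τ(u) = ∂₁ α₁ + ∂ᵢ αᵢ` of `𝒞 u` is
`-2 Ad(F)` applied to the covariant divergence of `α_𝔭`.

If `𝒞 u` is harmonic then so is `u`, since variations of `u` are among those of `𝒞 u`; conversely
the variations `exp(t φ X) u` of a harmonic map `u`, with `φ` a bump function and `X ∈ 𝔤`, already
force `τ(𝒞 u) = 0`, because conjugation by `𝒞 u` maps `τ(𝒞 u)` to its negative. That a smooth map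
into the conjugacy class of `h` has smooth local lifts comes from square roots: near a point
`g₀ h g₀⁻¹` the map `g₀⁻¹ f g₀ h` is the exponential of a `𝔭`-valued function `X`, and
`g₀ exp(X / 2)` is a lift.

For the associated family, `α_𝔭` is replaced by `cos θ α_𝔭 - sin θ α_𝔭(i ·)`, where `λ = exp(iθ)`.
The covariant derivative of `α_𝔭` is symmetric by the Maurer-Cartan equation, so the second term has
covariant divergence zero, and the first is divergence free along with `α_𝔭`.
-/

noncomputable section

namespace CartanHarmonic

section calculus

theorem fderiv_comp_prodMk_right {𝕜 E F X : Type*} [NontriviallyNormedField 𝕜]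
    [NormedAddCommGroup E] [NormedSpace 𝕜 E] [NormedAddCommGroup F] [NormedSpace 𝕜 F]
    [NormedAddCommGroup X] [NormedSpace 𝕜 X] {g : E × F → X} {a : E} {b : F}
    (hg : DifferentiableAt 𝕜 g (a, b)) (v : F) :
    fderiv 𝕜 (fun y => g (a, y)) b v = fderiv 𝕜 g (a, b) (0, v) := by
  have h : HasFDerivAt (fun y => g (a, y)) _ b :=
    HasFDerivAt.comp b hg.hasFDerivAt (hasFDerivAt_prodMk_right a b)
  simp [h.fderiv]

theorem hasDerivAt_comp_prodMk_left {𝕜 F X : Type*} [NontriviallyNormedField 𝕜]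
    [NormedAddCommGroup F] [NormedSpace 𝕜 F] [NormedAddCommGroup X] [NormedSpace 𝕜 X]
    {g : 𝕜 × F → X} {t : 𝕜} {b : F} (hg : DifferentiableAt 𝕜 g (t, b)) :
    HasDerivAt (fun s => g (s, b)) (fderiv 𝕜 g (t, b) (1, 0)) t := by
  have h : HasFDerivAt (fun s => g (s, b)) _ t :=
    HasFDerivAt.comp t hg.hasFDerivAt (hasFDerivAt_prodMk_left t b)
  simpa using h.hasDerivAt

theorem apply_mem_of_hasFDerivAt {E X : Type*} [NormedAddCommGroup E] [NormedSpace ℝ E]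
    [NormedAddCommGroup X] [NormedSpace ℝ X] {S : Submodule ℝ X} (hS : IsClosed (S : Set X))
    {f : E → X} {D : E →L[ℝ] X} {w : E} (hf : HasFDerivAt f D w) (hfS : ∀ᶠ x in nhds w, f x ∈ S)
    (v : E) : D v ∈ S := by
  have hline : HasDerivAt (fun t : ℝ => w + t • v) v 0 := by
    simpa using ((hasDerivAt_id (0 : ℝ)).smul_const v).const_add w
  have hfline : HasDerivAt (fun t : ℝ => f (w + t • v)) (D v) 0 :=
    HasFDerivAt.comp_hasDerivAt (l := f) (0 : ℝ) (by simpa using hf) hline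
  have hmem : ∀ᶠ t : ℝ in nhds 0, f (w + t • v) ∈ S :=
    hline.continuousAt.eventually (p := fun x => f x ∈ S) (by simpa using hfS)
  refine hS.mem_of_tendsto (hasDerivAt_iff_tendsto_slope.1 hfline) ?_
  filter_upwards [hmem.filter_mono nhdsWithin_le_nhds] with t ht
  rw [slope_def_module]
  exact S.smul_mem _ (S.sub_mem ht (by simpa using hfS.self_of_nhds))

theorem map_eq_re_smul_add_im_smul {X : Type*} [NormedAddCommGroup X] [NormedSpace ℝ X]
    (T : ℂ →L[ℝ] X) (v : ℂ) : T v = v.re • T 1 + v.im • T Complex.I := by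
  rw [← map_smul, ← map_smul, ← map_add]
  congr 1
  simp

variable {E X : Type*} [NormedAddCommGroup E] [NormedSpace ℝ E] [MeasurableSpace E] [BorelSpace E]
  {μ : Measure E} [NormedAddCommGroup X] [NormedSpace ℝ X]

theorem hasDerivAt_setIntegral_of_contDiffOn [IsFiniteMeasureOnCompacts μ] {g : ℝ × E → X}
    {U C : Set E} (hU : IsOpen U) (hg : ContDiffOn ℝ 1 g (univ ×ˢ U)) (hC : IsCompact C)
    (hCU : C ⊆ U) (t₀ : ℝ) :
    HasDerivAt (fun t => ∫ w in C, g (t, w) ∂μ) (∫ w in C, fderiv ℝ g (t₀, w) (1, 0) ∂μ) t₀ := by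
  have hΩ : IsOpen ((univ : Set ℝ) ×ˢ U) := isOpen_univ.prod hU
  have hd : ContinuousOn (fun p => fderiv ℝ g p (1, 0)) (univ ×ˢ U) :=
    (hg.continuousOn_fderiv_of_isOpen hΩ le_rfl).clm_apply continuousOn_const
  have hslice : ∀ t : ℝ, MapsTo (fun w : E => (t, w)) C ((univ : Set ℝ) ×ˢ U) :=
    fun t w hw => ⟨mem_univ _, hCU hw⟩
  have hcont : ∀ t : ℝ, ContinuousOn (fun w : E => (t, w)) C := fun t => by fun_prop
  obtain ⟨K, hK⟩ := ((isCompact_closedBall t₀ 1).prod hC).exists_bound_of_continuousOn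
    (hd.mono (prod_mono (subset_univ _) hCU))
  refine (hasDerivAt_integral_of_dominated_loc_of_deriv_le (μ := μ.restrict C)
    (F := fun t w => g (t, w)) (F' := fun t w => fderiv ℝ g (t, w) (1, 0)) (bound := fun _ => K)
    (Metric.closedBall_mem_nhds t₀ one_pos) ?_ ?_ ?_ ?_ ?_ ?_).2
  · exact Filter.Eventually.of_forall fun t =>
      (hg.continuousOn.comp (hcont t) (hslice t)).aestronglyMeasurable_of_isCompact hC
        hC.measurableSet
  · exact (hg.continuousOn.comp (hcont t₀) (hslice t₀)).integrableOn_compact hC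
  · exact (hd.comp (hcont t₀) (hslice t₀)).aestronglyMeasurable_of_isCompact hC hC.measurableSet
  · exact (ae_restrict_mem hC.measurableSet).mono fun w hw t ht => hK (t, w) ⟨ht, hw⟩
  · exact integrableOn_const hC.measure_lt_top.ne
  · exact (ae_restrict_mem hC.measurableSet).mono fun w hw t _ => hasDerivAt_comp_prodMk_left
      ((hg.contDiffAt (hΩ.mem_nhds (hslice t hw))).differentiableAt one_ne_zero)

variable [FiniteDimensional ℝ E] [μ.IsAddHaarMeasure]

theorem integral_fderiv_eq_zero {b : E → X} (hb : ContDiff ℝ 1 b) (hc : HasCompactSupport b)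
    (v : E) : ∫ w, fderiv ℝ b w v ∂μ = 0 := by
  have hd : Integrable (fun w => fderiv ℝ b w v) μ :=
    ((hb.continuous_fderiv one_ne_zero).clm_apply
      continuous_const).integrable_of_hasCompactSupport (hc.fderiv_apply ℝ v)
  simpa using integral_smul_fderiv_eq_neg_fderiv_smul_of_integrable (μ := μ)
    (f := fun _ : E => (1 : ℝ)) (g := b) (v := v) (by simp) (by simpa using hd)
    (by simpa using hb.continuous.integrable_of_hasCompactSupport hc)
    (fun _ _ => differentiableAt_const _) (fun w _ => hb.differentiable one_ne_zero w)

theorem setIntegral_fderiv_eq_zero {b : E → X} {U C : Set E} (hU : IsOpen U)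
    (hb : ContDiffOn ℝ 1 b U) (hC : IsCompact C) (hCU : C ⊆ U) (h0 : ∀ w ∈ U \ C, b w = 0)
    (v : E) : ∫ w in C, fderiv ℝ b w v ∂μ = 0 := by
  have hindU : ∀ w ∈ U, C.indicator b =ᶠ[nhds w] b := fun w hw => by
    filter_upwards [hU.mem_nhds hw] with x hx
    by_cases hxC : x ∈ C
    · exact indicator_of_mem hxC b
    · rw [indicator_of_notMem hxC, h0 x ⟨hx, hxC⟩]
  have hindC : ∀ w ∉ C, C.indicator b =ᶠ[nhds w] fun _ => 0 := fun w hw => by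
    filter_upwards [hC.isClosed.isOpen_compl.mem_nhds hw] with x hx using indicator_of_notMem hx b
  have hsmooth : ContDiff ℝ 1 (C.indicator b) := contDiff_iff_contDiffAt.2 fun w => by
    by_cases hw : w ∈ C
    · exact (hb.contDiffAt (hU.mem_nhds (hCU hw))).congr_of_eventuallyEq (hindU w (hCU hw))
    · exact contDiffAt_const.congr_of_eventuallyEq (hindC w hw)
  have hcompact : HasCompactSupport (C.indicator b) :=
    HasCompactSupport.intro hC fun w hw => indicator_of_notMem hw b
  calc ∫ w in C, fderiv ℝ b w v ∂μ = ∫ w in C, fderiv ℝ (C.indicator b) w v ∂μ :=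
        setIntegral_congr_fun hC.measurableSet fun w hw => by
          simp only [(hindU w (hCU hw)).fderiv_eq]
    _ = ∫ w, fderiv ℝ (C.indicator b) w v ∂μ :=
        setIntegral_eq_integral_of_forall_compl_eq_zero fun w hw => by simp [(hindC w hw).fderiv_eq]
    _ = 0 := integral_fderiv_eq_zero hsmooth hcompact v

end calculus

theorem completeSpace_of_finiteDimensional (X : Type*) [NormedAddCommGroup X] [NormedSpace ℝ X]
    [FiniteDimensional ℝ X] : CompleteSpace X :=
  FiniteDimensional.complete ℝ X

attribute [local instance] completeSpace_of_finiteDimensional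

section linearGroup

variable {A : Type*} [NormedRing A] {G : Subgroup Aˣ}

theorem mat_injective : Function.Injective (mat : G → A) := fun _ _ hab =>
  Subtype.ext (Units.ext hab)

@[simp] theorem mat_mul_inv_cancel_left (a : G) (X : A) : mat a * (mat a⁻¹ * X) = X := by
  rw [← mul_assoc, mat_mul_inv, one_mul]

@[simp] theorem mat_inv_mul_cancel_left (a : G) (X : A) : mat a⁻¹ * (mat a * X) = X := by
  rw [← mul_assoc, mat_inv_mul, one_mul]

theorem mat_conj_mul (a : G) (X Y : A) :
    mat a * (X * Y) * mat a⁻¹ = mat a * X * mat a⁻¹ * (mat a * Y * mat a⁻¹) := by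
  simp only [mul_assoc, mat_inv_mul_cancel_left]

theorem mat_conj_eq_zero_iff (a : G) {X : A} : mat a * X * mat a⁻¹ = 0 ↔ X = 0 := by
  refine ⟨fun hX => ?_, fun hX => by simp [hX]⟩
  simpa [mul_assoc] using congrArg (fun Y => mat a⁻¹ * Y * mat a) hX

theorem mat_mul_self {h : G} (hsq : h * h = 1) : mat h * mat h = 1 := by
  rw [← mat_mul, hsq, mat_one]

@[simp] theorem cartanEmbedding_mk (h g : G) :
    cartanEmbedding h (g : SymSpace h) = g * h * g⁻¹ := rfl

theorem cartanEmbedding_smul {h : G} (g : G) (x : SymSpace h) :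
    cartanEmbedding h (g • x) = g * cartanEmbedding h x * g⁻¹ := by
  induction x using QuotientGroup.induction_on with | H a => ?_
  change g * a * h * (g * a)⁻¹ = g * (a * h * a⁻¹) * g⁻¹
  group

theorem cartanEmbedding_injective (h : G) : Function.Injective (cartanEmbedding h) := by
  intro x y
  induction x using QuotientGroup.induction_on with | H a => ?_
  induction y using QuotientGroup.induction_on with | H b => ?_
  exact fun hab => QuotientGroup.eq.2 (conj_eq_conj_iff.1 hab)

theorem bijOn_cartanEmbedding (h : G) : BijOn (cartanEmbedding h) univ (conjClass h) := by
  refine ⟨fun x _ => ?_, (cartanEmbedding_injective h).injOn, ?_⟩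
  · induction x using QuotientGroup.induction_on with | H g => exact ⟨g, rfl⟩
  · rintro _ ⟨g, rfl⟩
    exact ⟨(g : SymSpace h), mem_univ _, rfl⟩

theorem cartanEmbedding_mul_self {h : G} (hsq : h * h = 1) (x : SymSpace h) :
    cartanEmbedding h x * cartanEmbedding h x = 1 := by
  induction x using QuotientGroup.induction_on with | H a => ?_
  calc a * h * a⁻¹ * (a * h * a⁻¹) = a * (h * h) * a⁻¹ := by group
    _ = 1 := by simp [hsq]

variable [NormedAlgebra ℝ A] {E : Type*} [NormedAddCommGroup E] [NormedSpace ℝ E]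

theorem SmoothOn.contDiffAt {F : E → G} {V : Set E} (hV : IsOpen V) (hF : SmoothOn F V) {w : E}
    (hw : w ∈ V) : ContDiffAt ℝ ∞ (fun x => mat (F x)) w :=
  ContDiffOn.contDiffAt hF (hV.mem_nhds hw)

theorem SmoothOn.differentiableAt {F : E → G} {V : Set E} (hV : IsOpen V) (hF : SmoothOn F V)
    {w : E} (hw : w ∈ V) : DifferentiableAt ℝ (fun x => mat (F x)) w :=
  (hF.contDiffAt hV hw).differentiableAt (by simp)

theorem SmoothOn.mono {F : E → G} {V W : Set E} (hF : SmoothOn F V) (h : W ⊆ V) : SmoothOn F W :=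
  ContDiffOn.mono hF h

theorem SmoothOn.congr {F H : E → G} {V : Set E} (hF : SmoothOn F V) (h : ∀ x ∈ V, H x = F x) :
    SmoothOn H V :=
  ContDiffOn.congr hF fun x hx => by rw [h x hx]

theorem SmoothOn.comp {E' : Type*} [NormedAddCommGroup E'] [NormedSpace ℝ E'] {F : E → G}
    {V : Set E} {f : E' → E} {W : Set E'} (hF : SmoothOn F V) (hf : ContDiffOn ℝ ∞ f W)
    (h : MapsTo f W V) : SmoothOn (fun x => F (f x)) W :=
  ContDiffOn.comp (g := fun x => mat (F x)) hF hf h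

theorem SmoothOn.slice {Φ : ℝ → E → G} {U : Set E}
    (hΦ : SmoothOn (fun p : ℝ × E => Φ p.1 p.2) (univ ×ˢ U)) (t : ℝ) : SmoothOn (Φ t) U :=
  hΦ.comp (f := fun w : E => (t, w)) (by fun_prop) fun _ hw => ⟨mem_univ _, hw⟩

theorem SmoothOn.conj [CompleteSpace A] {F : E → G} {V : Set E} (hF : SmoothOn F V) (h : G) :
    SmoothOn (fun x => F x * h * (F x)⁻¹) V :=
  (hF.mul (smoothOn_const h _)).mul hF.inv

theorem IsLift.cartanEmbedding_eq {h : G} {u : E → SymSpace h} {F : E → G} {V : Set E}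
    (hF : IsLift u F V) {x : E} (hx : x ∈ V) : cartanEmbedding h (u x) = F x * h * (F x)⁻¹ := by
  rw [hF.2 x hx, cartanEmbedding_mk]

theorem QuotSmoothOn.smoothOn [CompleteSpace A] {h : G} {u : E → SymSpace h} {U : Set E}
    (hu : QuotSmoothOn u U) : SmoothOn (fun x => cartanEmbedding h (u x)) U := by
  intro w hw
  obtain ⟨V, hV, hwV, F, hF⟩ := hu w hw
  have hV' : SmoothOn (fun x => cartanEmbedding h (u x)) V :=
    (hF.1.conj h).congr fun x hx => hF.cartanEmbedding_eq hx
  exact (hV'.contDiffAt hV hwV).contDiffWithinAt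

theorem QuotSmoothOn.smul {h : G} {u : E → SymSpace h} {g : E → G} {U : Set E}
    (hu : QuotSmoothOn u U) (hg : SmoothOn g univ) : QuotSmoothOn (fun x => g x • u x) U := by
  intro w hw
  obtain ⟨V, hV, hwV, F, hF⟩ := hu w hw
  exact ⟨V, hV, hwV, fun x => g x * F x, (hg.mono (subset_univ V)).mul hF.1, fun x hx => by
    simp only [hF.2 x hx]; rfl⟩

theorem QuotSmoothOn.comp {E' : Type*} [NormedAddCommGroup E'] [NormedSpace ℝ E'] {h : G}
    {u : E → SymSpace h} {U : Set E} {f : E' → E} {W : Set E'} (hu : QuotSmoothOn u U)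
    (hW : IsOpen W) (hf : ContDiffOn ℝ ∞ f W) (hm : MapsTo f W U) :
    QuotSmoothOn (fun x => u (f x)) W := by
  intro w hw
  obtain ⟨V, hV, hwV, F, hF⟩ := hu (f w) (hm hw)
  exact ⟨W ∩ f ⁻¹' V, hf.continuousOn.isOpen_inter_preimage hW hV, ⟨hw, hwV⟩, fun x => F (f x),
    hF.1.comp (hf.mono inter_subset_left) fun _ hx => hx.2, fun x hx => hF.2 (f x) hx.2⟩

theorem QuotSmoothOn.slice {h : G} {Φ : ℝ → E → SymSpace h} {U : Set E} (hU : IsOpen U)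
    (hΦ : QuotSmoothOn (fun p : ℝ × E => Φ p.1 p.2) (univ ×ˢ U)) (t : ℝ) :
    QuotSmoothOn (Φ t) U :=
  hΦ.comp (f := fun w : E => (t, w)) hU (by fun_prop) fun _ hw => ⟨mem_univ _, hw⟩

end linearGroup

section maurerCartan

variable {A : Type*} [NormedRing A] {G : Subgroup Aˣ} [NormedAlgebra ℝ A]
  {E : Type*} [NormedAddCommGroup E] [NormedSpace ℝ E]

theorem mat_mul_maurerCartan (F : E → G) (w v : E) :
    mat (F w) * maurerCartan F w v = fderiv ℝ (fun x => mat (F x)) w v :=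
  mat_mul_inv_cancel_left _ _

theorem maurerCartan_congr {F H : E → G} {V : Set E} (hV : IsOpen V) (h : ∀ x ∈ V, F x = H x)
    {w : E} (hw : w ∈ V) (v : E) : maurerCartan F w v = maurerCartan H w v := by
  have hFH : (fun x => mat (F x)) =ᶠ[nhds w] fun x => mat (H x) := by
    filter_upwards [hV.mem_nhds hw] with x hx
    rw [h x hx]
  simp only [maurerCartan, hFH.fderiv_eq, h w hw]

variable [CompleteSpace A]

theorem hasFDerivAt_mat_inv {F : E → G} {w : E} {D : E →L[ℝ] A}
    (hF : HasFDerivAt (fun x => mat (F x)) D w) :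
    HasFDerivAt (fun x => mat (F x)⁻¹)
      ((-ContinuousLinearMap.mulLeftRight ℝ A (mat (F w)⁻¹) (mat (F w)⁻¹)).comp D) w := by
  have hinv : (fun x => mat (F x)⁻¹) = Ring.inverse ∘ fun x => mat (F x) :=
    funext fun x => mat_inv_eq (F x)
  rw [hinv]
  exact (hasFDerivAt_ringInverse (𝕜 := ℝ) (F w : Aˣ)).comp w (f := fun x => mat (F x)) hF

theorem hasDerivAt_mat_inv {F : ℝ → G} {t : ℝ} {X : A} (hF : HasDerivAt (fun x => mat (F x)) X t) :
    HasDerivAt (fun x => mat (F x)⁻¹) (-(mat (F t)⁻¹ * X * mat (F t)⁻¹)) t := by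
  simpa using (hasFDerivAt_mat_inv hF.hasFDerivAt).hasDerivAt

theorem hasDerivAt_conj {γ : ℝ → G} {X : A} (h0 : γ 0 = 1)
    (h : HasDerivAt (fun t => mat (γ t)) X 0) (Y : A) :
    HasDerivAt (fun t => mat (γ t) * Y * mat (γ t)⁻¹) (X * Y - Y * X) 0 := by
  simpa [h0, sub_eq_add_neg] using (h.mul_const Y).fun_mul (hasDerivAt_mat_inv h)

theorem fderiv_conj {F : E → G} {V : Set E} (hV : IsOpen V) (hF : SmoothOn F V) {w : E} (hw : w ∈ V)
    {P : E → A} {P' : E →L[ℝ] A} (hP : HasFDerivAt P P' w) (v : E) :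
    fderiv ℝ (fun x => mat (F x) * P x * mat (F x)⁻¹) w v = mat (F w) *
      (P' v + maurerCartan F w v * P w - P w * maurerCartan F w v) * mat (F w)⁻¹ := by
  have hdF := (hF.differentiableAt hV hw).hasFDerivAt
  have hd : fderiv ℝ (fun x => mat (F x) * P x * mat (F x)⁻¹) w = _ :=
    ((hdF.mul' hP).mul' (hasFDerivAt_mat_inv hdF)).fderiv
  rw [hd]
  simp only [Pi.mul_apply, ContinuousLinearMap.neg_comp, smul_neg, add_apply, neg_apply,
    smul_apply, ContinuousLinearMap.comp_apply, ← mat_mul_maurerCartan,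
    ContinuousLinearMap.mulLeftRight_apply, mat_inv_mul_cancel_left, smul_eq_mul, mul_assoc,
    MulOpposite.smul_eq_mul_unop, MulOpposite.unop_op, mul_sub, mul_add, sub_mul, add_mul]
  abel

theorem contDiffOn_maurerCartan {F : E → G} {V : Set E} (hV : IsOpen V) (hF : SmoothOn F V)
    (a : E) : ContDiffOn ℝ ∞ (fun x => maurerCartan F x a) V := by
  have hinv : ContDiffOn ℝ ∞ (fun x => mat (F x)⁻¹) V := hF.inv
  have hderiv : ContDiffOn ℝ ∞ (fderiv ℝ (fun x => mat (F x))) V :=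
    ContDiffOn.fderiv_of_isOpen hF hV (by simp)
  exact hinv.mul (hderiv.clm_apply contDiffOn_const)

theorem differentiableAt_maurerCartan {F : E → G} {V : Set E} (hV : IsOpen V) (hF : SmoothOn F V)
    {w : E} (hw : w ∈ V) (a : E) : DifferentiableAt ℝ (fun x => maurerCartan F x a) w :=
  ((contDiffOn_maurerCartan hV hF a).contDiffAt (hV.mem_nhds hw)).differentiableAt (by simp)

theorem fderiv_maurerCartan {F : E → G} {V : Set E} (hV : IsOpen V) (hF : SmoothOn F V) {w : E}
    (hw : w ∈ V) (a b : E) :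
    fderiv ℝ (fun x => maurerCartan F x a) w b =
      mat (F w)⁻¹ * fderiv ℝ (fderiv ℝ (fun x => mat (F x))) w b a -
        maurerCartan F w b * maurerCartan F w a := by
  have hinv := hasFDerivAt_mat_inv (hF.differentiableAt hV hw).hasFDerivAt
  have hderiv : DifferentiableAt ℝ (fderiv ℝ (fun x => mat (F x))) w :=
    ((ContDiffOn.fderiv_of_isOpen hF hV (m := ∞) (by simp)).contDiffAt
      (hV.mem_nhds hw)).differentiableAt (by simp)
  have hmul : fderiv ℝ (fun x => maurerCartan F x a) w = _ :=
    (hinv.mul' (hderiv.hasFDerivAt.clm_apply (hasFDerivAt_const a w))).fderiv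
  rw [hmul]
  simp [maurerCartan, sub_eq_add_neg, mul_assoc]

/-- The Maurer-Cartan equation `dα + α ∧ α = 0`. -/
theorem fderiv_maurerCartan_sub_fderiv_maurerCartan {F : E → G} {V : Set E} (hV : IsOpen V)
    (hF : SmoothOn F V) {w : E} (hw : w ∈ V) (a b : E) :
    fderiv ℝ (fun x => maurerCartan F x a) w b - fderiv ℝ (fun x => maurerCartan F x b) w a =
      maurerCartan F w a * maurerCartan F w b - maurerCartan F w b * maurerCartan F w a := by
  have hsymm : IsSymmSndFDerivAt ℝ (fun x => mat (F x)) w :=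
    (hF.contDiffAt hV hw).isSymmSndFDerivAt
      (by simpa using WithTop.coe_le_coe.2 (le_top (a := (2 : ℕ∞))))
  rw [fderiv_maurerCartan hV hF hw, fderiv_maurerCartan hV hF hw, hsymm.eq a b]
  abel

end maurerCartan

section form

variable {A : Type*} [NormedRing A] {G : Subgroup Aˣ} [NormedAlgebra ℝ A] [FiniteDimensional ℝ A]

theorem conj_mem_lieAlg (g : G) {X : A} (hX : X ∈ lieAlg G) : mat g * X * mat g⁻¹ ∈ lieAlg G :=
  IsVelocity.conj hX g

theorem isClosed_lieAlg (G : Subgroup Aˣ) : IsClosed ((lieAlg G).toSubmodule : Set A) :=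
  (lieAlg G).toSubmodule.closed_of_finiteDimensional

theorem fderiv_maurerCartan_mem {E : Type*} [NormedAddCommGroup E] [NormedSpace ℝ E] {F : E → G}
    {V : Set E} (hV : IsOpen V) (hF : SmoothOn F V) {w : E} (hw : w ∈ V) (a b : E) :
    fderiv ℝ (fun x => maurerCartan F x a) w b ∈ lieAlg G :=
  apply_mem_of_hasFDerivAt (isClosed_lieAlg G)
    (differentiableAt_maurerCartan hV hF hw a).hasFDerivAt
    (Filter.eventually_of_mem (hV.mem_nhds hw) fun _ hx => maurerCartan_mem hV hF hx a) b

theorem exists_lieProj (G : Subgroup Aˣ) :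
    ∃ π : A →ₗ[ℝ] lieAlg G, π ∘ₗ (lieAlg G).toSubmodule.subtype = LinearMap.id :=
  LinearMap.exists_leftInverse_of_injective _ (Submodule.ker_subtype _)

/-- A linear projection of the matrix algebra onto the Lie algebra of `G`; its kernel is an
arbitrary complement. -/
def lieProj (G : Subgroup Aˣ) : A →ₗ[ℝ] lieAlg G := (exists_lieProj G).choose

theorem lieProj_of_mem {X : A} (hX : X ∈ lieAlg G) : lieProj G X = ⟨X, hX⟩ :=
  LinearMap.congr_fun (exists_lieProj G).choose_spec (⟨X, hX⟩ : lieAlg G)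

/-- The form of a bi-invariant metric, extended through `lieProj` to a continuous bilinear form on
the whole matrix algebra, so that it can be differentiated along matrix-valued maps. -/
def extForm (B : BiinvariantMetric G) : A →L[ℝ] A →L[ℝ] ℝ :=
  (B.form.compl₁₂ (lieProj G) (lieProj G)).toContinuousBilinearMap

variable (B : BiinvariantMetric G)

theorem extForm_of_mem {X Y : A} (hX : X ∈ lieAlg G) (hY : Y ∈ lieAlg G) :
    extForm B X Y = B.form ⟨X, hX⟩ ⟨Y, hY⟩ := by
  simp [extForm, lieProj_of_mem hX, lieProj_of_mem hY]

theorem extForm_comm (X Y : A) : extForm B X Y = extForm B Y X := by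
  simpa [extForm] using B.symm.eq (lieProj G X) (lieProj G Y)

theorem normSq_eq_extForm {X : A} (hX : X ∈ lieAlg G) : normSq B X = extForm B X X := by
  rw [extForm_of_mem B hX hX, normSq, dif_pos hX]

theorem normSq_smul {X : A} (hX : X ∈ lieAlg G) (c : ℝ) :
    normSq B (c • X) = c ^ 2 * normSq B X := by
  rw [normSq_eq_extForm B hX, normSq_eq_extForm B ((lieAlg G).smul_mem c hX), map_smul, map_smul,
    smul_apply, smul_eq_mul, smul_eq_mul]
  ring

theorem extForm_conj (g : G) {X Y : A} (hX : X ∈ lieAlg G) (hY : Y ∈ lieAlg G) :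
    extForm B (mat g * X * mat g⁻¹) (mat g * Y * mat g⁻¹) = extForm B X Y := by
  rw [extForm_of_mem B hX hY, extForm_of_mem B (conj_mem_lieAlg g hX) (conj_mem_lieAlg g hY)]
  exact B.invariant g ⟨X, hX⟩ ⟨Y, hY⟩

theorem eq_zero_of_extForm {Y : A} (hY : Y ∈ lieAlg G)
    (h : ∀ X ∈ lieAlg G, extForm B X Y = 0) : Y = 0 := by
  have hzero : (⟨Y, hY⟩ : lieAlg G) = 0 := B.nondegenerate.2 ⟨Y, hY⟩ fun X => by
    rw [← h X X.2, extForm_of_mem B X.2 hY]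
  exact congrArg Subtype.val hzero

theorem extForm_commutator {X Z : A} (hX : X ∈ lieAlg G) (hZ : Z ∈ lieAlg G) :
    extForm B (Z * X - X * Z) Z = 0 := by
  obtain ⟨γ, -, h0, hγ⟩ := id hZ
  have hderiv : HasDerivAt (fun t => extForm B (mat (γ t) * X * mat (γ t)⁻¹)
      (mat (γ t) * Z * mat (γ t)⁻¹)) _ 0 :=
    ((extForm B).hasFDerivAt.comp_hasDerivAt (0 : ℝ) (hasDerivAt_conj h0 hγ X)).clm_apply
      (hasDerivAt_conj h0 hγ Z)
  simp only [extForm_conj B _ hX hZ] at hderiv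
  simpa [h0] using hderiv.unique (hasDerivAt_const _ _)

end form

section symmetricDecomposition

variable {A : Type*} [NormedRing A] {G : Subgroup Aˣ} [NormedAlgebra ℝ A]

/-- The projection `X ↦ pPart h X` as a continuous linear map. -/
def pPartCLM (h : G) : A →L[ℝ] A :=
  (1 / 2 : ℝ) • (ContinuousLinearMap.id ℝ A -
    ContinuousLinearMap.mulLeftRight ℝ A (mat h) (mat h⁻¹))

theorem pPartCLM_apply (h : G) (X : A) : pPartCLM h X = pPart h X := by
  simp [pPartCLM, pPart]

theorem pPart_add (h : G) (X Y : A) : pPart h (X + Y) = pPart h X + pPart h Y := by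
  simp only [← pPartCLM_apply, map_add]

theorem pPart_sub (h : G) (X Y : A) : pPart h (X - Y) = pPart h X - pPart h Y := by
  simp only [← pPartCLM_apply, map_sub]

theorem pPart_smul (h : G) (c : ℝ) (X : A) : pPart h (c • X) = c • pPart h X := by
  simp only [← pPartCLM_apply, map_smul]

theorem kPart_add_pPart (h : G) (X : A) : kPart h X + pPart h X = X := by
  simp only [kPart, pPart]
  module

theorem kPart_eq_sub (h : G) (X : A) : kPart h X = X - pPart h X :=
  eq_sub_of_add_eq (kPart_add_pPart h X)

theorem pPart_mul (h : G) (X Y : A) :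
    pPart h (X * Y) = kPart h X * pPart h Y + pPart h X * kPart h Y := by
  simp only [pPart, kPart, mat_conj_mul, smul_mul_smul_comm, add_mul, mul_add, sub_mul, mul_sub]
  module

theorem mat_conj_pPart {h : G} (hsq : h * h = 1) (X : A) :
    mat h * pPart h X * mat h⁻¹ = -pPart h X := by
  have hinv : h⁻¹ = h := inv_eq_of_mul_eq_one_left hsq
  have hconj : mat h * (mat h * X * mat h) * mat h = X := by
    rw [mul_assoc, mul_assoc _ (mat h) (mat h), mat_mul_self hsq, mul_one, ← mul_assoc,
      mat_mul_self hsq, one_mul]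
  rw [pPart, hinv, mul_smul_comm, smul_mul_assoc, mul_sub, sub_mul, hconj, ← smul_neg, neg_sub]

theorem pPart_pPart {h : G} (hsq : h * h = 1) (X : A) : pPart h (pPart h X) = pPart h X := by
  rw [pPart, mat_conj_pPart hsq]
  module

theorem kPart_pPart {h : G} (hsq : h * h = 1) (X : A) : kPart h (pPart h X) = 0 := by
  rw [kPart_eq_sub, pPart_pPart hsq, sub_self]

theorem pPart_kPart {h : G} (hsq : h * h = 1) (X : A) : pPart h (kPart h X) = 0 := by
  rw [kPart_eq_sub, pPart_sub, pPart_pPart hsq, sub_self]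

theorem kPart_kPart {h : G} (hsq : h * h = 1) (X : A) : kPart h (kPart h X) = kPart h X := by
  rw [kPart_eq_sub h (kPart h X), pPart_kPart hsq, sub_zero]

theorem pPart_commutator {h : G} (hsq : h * h = 1) (X Y : A) :
    pPart h (kPart h X * pPart h Y - pPart h Y * kPart h X) =
      kPart h X * pPart h Y - pPart h Y * kPart h X := by
  simp only [pPart_sub, pPart_mul, pPart_kPart hsq, kPart_pPart hsq, kPart_kPart hsq,
    pPart_pPart hsq, mul_zero, add_zero, zero_add]

end symmetricDecomposition

section tension

variable {A : Type*} [NormedRing A] {G : Subgroup Aˣ} [NormedAlgebra ℝ A]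

/-- The Euler-Lagrange operator of the energy of maps from an open subset of `ℂ` into `G`: the
divergence `∂₁ α₁ + ∂ᵢ αᵢ` of the form `α = u⁻¹ du`. -/
def tension (u : ℂ → G) (w : ℂ) : A :=
  fderiv ℝ (fun x => maurerCartan u x 1) w 1 +
    fderiv ℝ (fun x => maurerCartan u x Complex.I) w Complex.I

theorem tension_congr {u u' : ℂ → G} {V : Set ℂ} (hV : IsOpen V) (h : ∀ x ∈ V, u x = u' x) {w : ℂ}
    (hw : w ∈ V) : tension u w = tension u' w := by
  have hα : ∀ v : ℂ, (fun x => maurerCartan u x v) =ᶠ[nhds w] fun x => maurerCartan u' x v :=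
    fun v => by filter_upwards [hV.mem_nhds hw] with x hx using maurerCartan_congr hV h hx v
  simp only [tension, (hα _).fderiv_eq]

theorem contDiffOn_tension [CompleteSpace A] {u : ℂ → G} {U : Set ℂ} (hU : IsOpen U)
    (hu : SmoothOn u U) : ContDiffOn ℝ ∞ (tension u) U := by
  have hα : ∀ v : ℂ, ContDiffOn ℝ ∞ (fun w => fderiv ℝ (fun x => maurerCartan u x v) w v) U :=
    fun v => ((contDiffOn_maurerCartan hU hu v).fderiv_of_isOpen hU (by simp)).clm_apply
      contDiffOn_const
  exact (hα 1).add (hα Complex.I)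

theorem tension_mem [FiniteDimensional ℝ A] {u : ℂ → G} {U : Set ℂ} (hU : IsOpen U)
    (hu : SmoothOn u U) {w : ℂ} (hw : w ∈ U) : tension u w ∈ lieAlg G :=
  (lieAlg G).add_mem (fderiv_maurerCartan_mem hU hu hw 1 1)
    (fderiv_maurerCartan_mem hU hu hw Complex.I Complex.I)

end tension

section cartanEmbedding

variable {A : Type*} [NormedRing A] {G : Subgroup Aˣ} [NormedAlgebra ℝ A]
  {E : Type*} [NormedAddCommGroup E] [NormedSpace ℝ E]

/-- The second fundamental form `(v, v') ↦ ∇_v (dF K)(v')` of the map `F K` into `G / K`, translated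
to `𝔭`: the `𝔭`-part of `α = F⁻¹ dF` is differentiated with the connection given by the `𝔨`-part. -/
def covDeriv (h : G) (F : E → G) (w v v' : E) : A :=
  fderiv ℝ (fun x => pPart h (maurerCartan F x v')) w v +
    (kPart h (maurerCartan F w v) * pPart h (maurerCartan F w v') -
      pPart h (maurerCartan F w v') * kPart h (maurerCartan F w v))

/-- The tension field of `F K`, translated to `𝔭`. -/
def covariantDivergence (h : G) (F : ℂ → G) (w : ℂ) : A :=
  covDeriv h F w 1 1 + covDeriv h F w Complex.I Complex.I

variable [CompleteSpace A] {h : G} {F : E → G} {V : Set E} {w : E}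

theorem hasFDerivAt_pPart_maurerCartan (hV : IsOpen V) (hF : SmoothOn F V) (hw : w ∈ V) (v : E) :
    HasFDerivAt (fun x => pPart h (maurerCartan F x v))
      ((pPartCLM h).comp (fderiv ℝ (fun x => maurerCartan F x v) w)) w := by
  simp only [← pPartCLM_apply]
  exact (pPartCLM h).hasFDerivAt.comp w (differentiableAt_maurerCartan hV hF hw v).hasFDerivAt

theorem pPart_covDeriv (hsq : h * h = 1) (hV : IsOpen V) (hF : SmoothOn F V) (hw : w ∈ V)
    (v v' : E) : pPart h (covDeriv h F w v v') = covDeriv h F w v v' := by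
  rw [covDeriv, pPart_add, pPart_commutator hsq,
    (hasFDerivAt_pPart_maurerCartan hV hF hw v').fderiv, ContinuousLinearMap.comp_apply,
    pPartCLM_apply, pPart_pPart hsq]

theorem maurerCartan_conj (hsq : h * h = 1) (hV : IsOpen V) (hF : SmoothOn F V) (hw : w ∈ V)
    (v : E) : maurerCartan (fun x => F x * h * (F x)⁻¹) w v =
      (-2 : ℝ) • (mat (F w) * pPart h (maurerCartan F w v) * mat (F w)⁻¹) := by
  have hinv : h⁻¹ = h := inv_eq_of_mul_eq_one_left hsq
  have hd : fderiv ℝ (fun x => mat (F x * h * (F x)⁻¹)) w v = mat (F w) *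
      (maurerCartan F w v * mat h - mat h * maurerCartan F w v) * mat (F w)⁻¹ := by
    simpa using fderiv_conj hV hF hw (hasFDerivAt_const (mat h) w) v
  have hsq' : ∀ X : A, mat h * (mat h * X) = X := fun X => by
    rw [← mul_assoc, mat_mul_self hsq, one_mul]
  calc maurerCartan (fun x => F x * h * (F x)⁻¹) w v
      = mat (F w) * (mat h * maurerCartan F w v * mat h⁻¹ - maurerCartan F w v) *
          mat (F w)⁻¹ := by
        rw [maurerCartan, hd]
        simp only [mul_inv_rev, inv_inv, mat_mul, hinv, mul_assoc, mat_inv_mul_cancel_left,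
          mul_sub, sub_mul, hsq']
    _ = _ := by
        rw [pPart, mul_smul_comm, smul_mul_assoc, smul_smul, ← neg_sub (maurerCartan F w v),
          mul_neg, neg_mul, ← neg_one_smul ℝ (_ * _)]
        norm_num

theorem fderiv_maurerCartan_conj (hsq : h * h = 1) (hV : IsOpen V) (hF : SmoothOn F V) (hw : w ∈ V)
    (v : E) : fderiv ℝ (fun x => maurerCartan (fun x => F x * h * (F x)⁻¹) x v) w v =
      (-2 : ℝ) • (mat (F w) * covDeriv h F w v v * mat (F w)⁻¹) := by
  have hα : (fun x => maurerCartan (fun x => F x * h * (F x)⁻¹) x v) =ᶠ[nhds w] fun x =>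
      (-2 : ℝ) • (mat (F x) * pPart h (maurerCartan F x v) * mat (F x)⁻¹) := by
    filter_upwards [hV.mem_nhds hw] with x hx using maurerCartan_conj hsq hV hF hx v
  have hp := hasFDerivAt_pPart_maurerCartan hV hF hw v (h := h)
  have hcomm : maurerCartan F w v * pPart h (maurerCartan F w v) -
      pPart h (maurerCartan F w v) * maurerCartan F w v =
        kPart h (maurerCartan F w v) * pPart h (maurerCartan F w v) -
          pPart h (maurerCartan F w v) * kPart h (maurerCartan F w v) := by
    simp only [kPart_eq_sub, sub_mul, mul_sub, sub_sub_sub_cancel_right]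
  have hd : DifferentiableAt ℝ
      (fun x => mat (F x) * pPart h (maurerCartan F x v) * mat (F x)⁻¹) w :=
    (((hF.differentiableAt hV hw).mul hp.differentiableAt).mul
      (hF.inv.differentiableAt hV hw))
  rw [hα.fderiv_eq, fderiv_fun_const_smul hd, smul_apply, fderiv_conj hV hF hw hp, add_sub_assoc,
    hcomm, covDeriv, hp.fderiv]

theorem tension_conj {F : ℂ → G} {V : Set ℂ} {w : ℂ} (hsq : h * h = 1) (hV : IsOpen V)
    (hF : SmoothOn F V) (hw : w ∈ V) : tension (fun x => F x * h * (F x)⁻¹) w =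
      (-2 : ℝ) • (mat (F w) * covariantDivergence h F w * mat (F w)⁻¹) := by
  simp only [tension, fderiv_maurerCartan_conj hsq hV hF hw, covariantDivergence, ← smul_add,
    ← add_mul, ← mul_add]

theorem tension_cartanEmbedding_eq_zero_iff {u : ℂ → SymSpace h} {F : ℂ → G} {V : Set ℂ}
    (hsq : h * h = 1) (hV : IsOpen V) (hF : IsLift u F V) {w : ℂ} (hw : w ∈ V) :
    tension (fun x => cartanEmbedding h (u x)) w = 0 ↔ covariantDivergence h F w = 0 := by
  rw [tension_congr hV (fun _ hx => hF.cartanEmbedding_eq hx) hw, tension_conj hsq hV hF.1 hw,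
    smul_eq_zero_iff_right (by norm_num), mat_conj_eq_zero_iff]

theorem conj_tension_cartanEmbedding {u : ℂ → SymSpace h} {U : Set ℂ} (hsq : h * h = 1)
    (hu : QuotSmoothOn u U) {w : ℂ} (hw : w ∈ U) :
    mat (cartanEmbedding h (u w)) * tension (fun x => cartanEmbedding h (u x)) w *
      mat (cartanEmbedding h (u w))⁻¹ = -tension (fun x => cartanEmbedding h (u x)) w := by
  obtain ⟨V, hV, hwV, F, hF⟩ := hu w hw
  have hD : mat h * covariantDivergence h F w * mat h⁻¹ = -covariantDivergence h F w := by
    rw [covariantDivergence, ← pPart_covDeriv hsq hV hF.1 hwV 1 1,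
      ← pPart_covDeriv hsq hV hF.1 hwV Complex.I Complex.I, ← pPart_add, mat_conj_pPart hsq]
  rw [tension_congr hV (fun _ hx => hF.cartanEmbedding_eq hx) hwV, hF.cartanEmbedding_eq hwV,
    tension_conj hsq hV hF.1 hwV]
  calc _ = (-2 : ℝ) • (mat (F w) * (mat h * covariantDivergence h F w * mat h⁻¹) *
        mat (F w)⁻¹) := by
        simp only [mat_mul, mul_inv_rev, inv_inv, mul_smul_comm, smul_mul_assoc, mul_assoc,
          mat_inv_mul_cancel_left]
    _ = _ := by simp only [hD, mul_neg, neg_mul, smul_neg]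

end cartanEmbedding

section energy

variable {A : Type*} [NormedRing A] {G : Subgroup Aˣ} [NormedAlgebra ℝ A] [FiniteDimensional ℝ A]
  (B : BiinvariantMetric G)

theorem pPart_mem (h : G) {X : A} (hX : X ∈ lieAlg G) : pPart h X ∈ lieAlg G :=
  (lieAlg G).smul_mem _ ((lieAlg G).sub_mem hX (conj_mem_lieAlg h hX))

theorem normSq_maurerCartan_conj {E : Type*} [NormedAddCommGroup E] [NormedSpace ℝ E] {h : G}
    {F : E → G} {V : Set E} (hsq : h * h = 1) (hV : IsOpen V) (hF : SmoothOn F V) {w : E}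
    (hw : w ∈ V) (v : E) :
    normSq B (maurerCartan (fun x => F x * h * (F x)⁻¹) w v) =
      4 * normSq B (pPart h (maurerCartan F w v)) := by
  have hp := pPart_mem h (maurerCartan_mem hV hF hw v)
  rw [maurerCartan_conj hsq hV hF hw, normSq_smul B (conj_mem_lieAlg _ hp), normSq_conj]
  norm_num

theorem energyDensity_cartanEmbedding {h : G} {u : ℂ → SymSpace h} {U : Set ℂ} (hsq : h * h = 1)
    (hu : QuotSmoothOn u U) {w : ℂ} (hw : w ∈ U) :
    energyDensity B (fun x => cartanEmbedding h (u x)) w = 4 * quotEnergyDensity B u w := by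
  obtain ⟨V, hV, hwV, F, hF⟩ := hu w hw
  simp only [quotEnergyDensity_eq B hV hF hwV, energyDensity, liftEnergyDensity,
    maurerCartan_congr hV (fun _ hx => hF.cartanEmbedding_eq hx) hwV,
    normSq_maurerCartan_conj B hsq hV hF.1 hwV]
  ring

theorem setIntegral_energyDensity_cartanEmbedding {h : G} {u : ℂ → SymSpace h} {U C : Set ℂ}
    (hsq : h * h = 1) (hu : QuotSmoothOn u U) (hC : MeasurableSet C) (hCU : C ⊆ U) :
    ∫ w in C, energyDensity B (fun x => cartanEmbedding h (u x)) w =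
      4 * ∫ w in C, quotEnergyDensity B u w := by
  rw [← integral_const_mul]
  exact setIntegral_congr_fun hC fun w hw => energyDensity_cartanEmbedding B hsq hu (hCU hw)

end energy

section firstVariation

variable {A : Type*} [NormedRing A] {G : Subgroup Aˣ} [NormedAlgebra ℝ A]
  {E : Type*}

/-- The velocity `Φ₀⁻¹ ∂ₜΦ` at time `0` of a variation, translated to the identity. -/
def variationField (Φ : ℝ → E → G) (w : E) : A :=
  mat (Φ 0 w)⁻¹ * deriv (fun t => mat (Φ t w)) 0

theorem variationField_eq_zero {Φ : ℝ → E → G} {w : E} (hw : ∀ t, Φ t w = Φ 0 w) :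
    variationField Φ w = 0 := by
  simp [variationField, hw]

variable [NormedAddCommGroup E] [NormedSpace ℝ E] {Φ : ℝ → E → G} {U C : Set E} {w : E}

theorem maurerCartan_slice (hU : IsOpen U) (hΦ : SmoothOn (fun p : ℝ × E => Φ p.1 p.2) (univ ×ˢ U))
    (t : ℝ) (hw : w ∈ U) (v : E) :
    maurerCartan (Φ t) w v = maurerCartan (fun p : ℝ × E => Φ p.1 p.2) (t, w) (0, v) := by
  simp only [maurerCartan, ← fderiv_comp_prodMk_right
    (hΦ.differentiableAt (isOpen_univ.prod hU) (w := (t, w)) ⟨mem_univ _, hw⟩)]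

theorem variationField_eq_maurerCartan (hU : IsOpen U)
    (hΦ : SmoothOn (fun p : ℝ × E => Φ p.1 p.2) (univ ×ˢ U)) (hw : w ∈ U) :
    variationField Φ w = maurerCartan (fun p : ℝ × E => Φ p.1 p.2) (0, w) (1, 0) := by
  simp only [maurerCartan, variationField, (hasDerivAt_comp_prodMk_left
    (hΦ.differentiableAt (isOpen_univ.prod hU) (w := (0, w)) ⟨mem_univ _, hw⟩)).deriv]

theorem contDiffOn_variationField [CompleteSpace A] (hU : IsOpen U)
    (hΦ : SmoothOn (fun p : ℝ × E => Φ p.1 p.2) (univ ×ˢ U)) :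
    ContDiffOn ℝ ∞ (variationField Φ) U :=
  ((contDiffOn_maurerCartan (isOpen_univ.prod hU) hΦ (1, 0)).comp (f := fun x : E => ((0 : ℝ), x))
    (by fun_prop) fun _ hx => ⟨mem_univ _, hx⟩).congr
    fun _ hx => variationField_eq_maurerCartan hU hΦ hx

variable [FiniteDimensional ℝ A] (B : BiinvariantMetric G)

theorem contDiffOn_extForm {X Y : E → A} (hX : ContDiffOn ℝ ∞ X U) (hY : ContDiffOn ℝ ∞ Y U) :
    ContDiffOn ℝ ∞ (fun x => extForm B (X x) (Y x)) U :=
  ((extForm B).contDiff.comp_contDiffOn hX).clm_apply hY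

theorem fderiv_extForm {X Y : E → A} (hX : DifferentiableAt ℝ X w) (hY : DifferentiableAt ℝ Y w)
    (v : E) : fderiv ℝ (fun x => extForm B (X x) (Y x)) w v =
      extForm B (X w) (fderiv ℝ Y w v) + extForm B (fderiv ℝ X w v) (Y w) := by
  rw [(extForm B).fderiv_of_bilinear hX hY]
  rfl

/-- Differentiating `⟨α_a, α_a⟩` in the direction `η` produces `⟨∂_η α_a, α_a⟩`; by the
Maurer-Cartan equation `∂_η α_a` is `∂_a α_η` up to a commutator with `α_a`, which is orthogonal to
`α_a`. -/
theorem fderiv_extForm_maurerCartan {F : E → G} (hU : IsOpen U) (hF : SmoothOn F U) (hw : w ∈ U)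
    (a η : E) : fderiv ℝ (fun x => extForm B (maurerCartan F x a) (maurerCartan F x a)) w η =
      2 * (fderiv ℝ (fun x => extForm B (maurerCartan F x η) (maurerCartan F x a)) w a -
        extForm B (maurerCartan F w η) (fderiv ℝ (fun x => maurerCartan F x a) w a)) := by
  have hd := differentiableAt_maurerCartan hU hF hw
  have hcomm : extForm B (fderiv ℝ (fun x => maurerCartan F x a) w η -
      fderiv ℝ (fun x => maurerCartan F x η) w a) (maurerCartan F w a) = 0 := by
    rw [fderiv_maurerCartan_sub_fderiv_maurerCartan hU hF hw]
    exact extForm_commutator B (maurerCartan_mem hU hF hw η) (maurerCartan_mem hU hF hw a)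
  rw [map_sub, sub_apply, sub_eq_zero] at hcomm
  rw [fderiv_extForm B (hd a) (hd a), fderiv_extForm B (hd η) (hd a), ← hcomm,
    extForm_comm B (maurerCartan F w a)]
  ring

theorem fderiv_extForm_maurerCartan_variation (hU : IsOpen U)
    (hΦ : SmoothOn (fun p : ℝ × E => Φ p.1 p.2) (univ ×ˢ U)) (hw : w ∈ U) (v : E) :
    fderiv ℝ (fun p : ℝ × E => extForm B (maurerCartan (fun p : ℝ × E => Φ p.1 p.2) p (0, v))
        (maurerCartan (fun p : ℝ × E => Φ p.1 p.2) p (0, v))) (0, w) (1, 0) =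
      2 * (fderiv ℝ (fun x => extForm B (variationField Φ x) (maurerCartan (Φ 0) x v)) w v -
        extForm B (variationField Φ w) (fderiv ℝ (fun x => maurerCartan (Φ 0) x v) w v)) := by
  set Ψ : ℝ × E → G := fun p => Φ p.1 p.2
  have hΩ : IsOpen ((univ : Set ℝ) ×ˢ U) := isOpen_univ.prod hU
  have hp : ((0 : ℝ), w) ∈ (univ : Set ℝ) ×ˢ U := ⟨mem_univ _, hw⟩
  have hα := differentiableAt_maurerCartan hΩ hΦ hp (0, v)
  have hη := differentiableAt_maurerCartan hΩ hΦ hp (1, 0)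
  have hηα : DifferentiableAt ℝ
      (fun p => extForm B (maurerCartan Ψ p (1, 0)) (maurerCartan Ψ p (0, v))) (0, w) :=
    ((extForm B).differentiableAt.comp _ hη).clm_apply hα
  have hα₀ : (fun x => maurerCartan (Φ 0) x v) =ᶠ[nhds w]
      fun x => maurerCartan Ψ (0, x) (0, v) := by
    filter_upwards [hU.mem_nhds hw] with x hx using maurerCartan_slice hU hΦ 0 hx v
  have hηα₀ : (fun x => extForm B (variationField Φ x) (maurerCartan (Φ 0) x v)) =ᶠ[nhds w]
      fun x => extForm B (maurerCartan Ψ (0, x) (1, 0)) (maurerCartan Ψ (0, x) (0, v)) := by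
    filter_upwards [hU.mem_nhds hw] with x hx
    rw [variationField_eq_maurerCartan hU hΦ hx, maurerCartan_slice hU hΦ 0 hx]
  rw [fderiv_extForm_maurerCartan B hΩ hΦ hp, hα₀.fderiv_eq, hηα₀.fderiv_eq,
    fderiv_comp_prodMk_right hα, variationField_eq_maurerCartan hU hΦ hw]
  congr 2
  exact (fderiv_comp_prodMk_right hηα v).symm

variable [MeasurableSpace E] [BorelSpace E] [FiniteDimensional ℝ E] {μ : Measure E}
  [μ.IsAddHaarMeasure]

theorem hasDerivAt_setIntegral_extForm_maurerCartan (hU : IsOpen U)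
    (hΦ : SmoothOn (fun p : ℝ × E => Φ p.1 p.2) (univ ×ˢ U)) (hC : IsCompact C) (hCU : C ⊆ U)
    (hΦC : ∀ t, ∀ w ∈ U \ C, Φ t w = Φ 0 w) (v : E) :
    HasDerivAt
      (fun t => ∫ w in C, extForm B (maurerCartan (Φ t) w v) (maurerCartan (Φ t) w v) ∂μ)
      (-2 * ∫ w in C, extForm B (variationField Φ w)
        (fderiv ℝ (fun x => maurerCartan (Φ 0) x v) w v) ∂μ) 0 := by
  set Ψ : ℝ × E → G := fun p => Φ p.1 p.2
  set b : E → ℝ := fun x => extForm B (variationField Φ x) (maurerCartan (Φ 0) x v)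
  set d : E → A := fun w => fderiv ℝ (fun x => maurerCartan (Φ 0) x v) w v
  have hΩ : IsOpen ((univ : Set ℝ) ×ˢ U) := isOpen_univ.prod hU
  have hα := contDiffOn_maurerCartan hU (hΦ.slice 0) v
  have hη := contDiffOn_variationField hU hΦ
  have hb : ContDiffOn ℝ ∞ b U := contDiffOn_extForm B hη hα
  have hfb : IntegrableOn (fun w => fderiv ℝ b w v) C μ :=
    (((hb.continuousOn_fderiv_of_isOpen hU (by simp)).clm_apply
      continuousOn_const).mono hCU).integrableOn_compact hC
  have hηd : IntegrableOn (fun w => extForm B (variationField Φ w) (d w)) C μ :=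
    ((contDiffOn_extForm B hη ((hα.fderiv_of_isOpen hU (m := ∞) (by simp)).clm_apply
      contDiffOn_const)).continuousOn.mono hCU).integrableOn_compact hC
  have hpoint : ∀ w ∈ C, fderiv ℝ (fun p => extForm B (maurerCartan Ψ p (0, v))
      (maurerCartan Ψ p (0, v))) (0, w) (1, 0) =
        2 * (fderiv ℝ b w v - extForm B (variationField Φ w) (d w)) :=
    fun w hw => fderiv_extForm_maurerCartan_variation B hU hΦ (hCU hw) v
  have hderiv := hasDerivAt_setIntegral_of_contDiffOn (μ := μ) hU
    ((contDiffOn_extForm B (contDiffOn_maurerCartan hΩ hΦ (0, v))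
      (contDiffOn_maurerCartan hΩ hΦ (0, v))).of_le (by simp)) hC hCU 0
  have hzero : ∫ w in C, fderiv ℝ b w v ∂μ = 0 :=
    setIntegral_fderiv_eq_zero hU (hb.of_le (by simp)) hC hCU (fun w hw => by
      simp [b, variationField_eq_zero fun t => hΦC t w hw]) v
  rw [setIntegral_congr_fun hC.measurableSet hpoint, integral_const_mul, integral_sub hfb hηd,
    hzero] at hderiv
  convert! hderiv using 1
  · funext t
    exact setIntegral_congr_fun hC.measurableSet fun w hw => by
      simp only [maurerCartan_slice hU hΦ t (hCU hw), Ψ]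
  · ring

theorem setIntegral_energyDensity {u : ℂ → G} {U C : Set ℂ} (hU : IsOpen U) (hu : SmoothOn u U)
    (hC : IsCompact C) (hCU : C ⊆ U) :
    ∫ w in C, energyDensity B u w =
      1 / 2 * (∫ w in C, extForm B (maurerCartan u w 1) (maurerCartan u w 1)) +
        1 / 2 * ∫ w in C, extForm B (maurerCartan u w Complex.I) (maurerCartan u w Complex.I) := by
  have hint : ∀ v : ℂ, IntegrableOn
      (fun w => extForm B (maurerCartan u w v) (maurerCartan u w v)) C := fun v =>
    ((contDiffOn_extForm B (contDiffOn_maurerCartan hU hu v)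
      (contDiffOn_maurerCartan hU hu v)).continuousOn.mono hCU).integrableOn_compact hC
  rw [← mul_add, ← integral_add (hint 1) (hint Complex.I), ← integral_const_mul]
  exact setIntegral_congr_fun hC.measurableSet fun w hw => by
    simp only [energyDensity, normSq_eq_extForm B (maurerCartan_mem hU hu (hCU hw) _)]

theorem hasDerivAt_setIntegral_energyDensity {Φ : ℝ → ℂ → G} {U C : Set ℂ} (hU : IsOpen U)
    (hΦ : SmoothOn (fun p : ℝ × ℂ => Φ p.1 p.2) (univ ×ˢ U)) (hC : IsCompact C) (hCU : C ⊆ U)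
    (hΦC : ∀ t, ∀ w ∈ U \ C, Φ t w = Φ 0 w) :
    HasDerivAt (fun t => ∫ w in C, energyDensity B (Φ t) w)
      (-∫ w in C, extForm B (variationField Φ w) (tension (Φ 0) w)) 0 := by
  have hderiv := fun v =>
    (hasDerivAt_setIntegral_extForm_maurerCartan B (μ := volume) hU hΦ hC hCU hΦC v).const_mul
      (1 / 2 : ℝ)
  have hint : ∀ v : ℂ, IntegrableOn (fun w => extForm B (variationField Φ w)
      (fderiv ℝ (fun x => maurerCartan (Φ 0) x v) w v)) C := fun v =>
    ((contDiffOn_extForm B (contDiffOn_variationField hU hΦ)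
      (((contDiffOn_maurerCartan hU (hΦ.slice 0) v).fderiv_of_isOpen hU (m := ∞)
        (by simp)).clm_apply contDiffOn_const)).continuousOn.mono hCU).integrableOn_compact hC
  simp only [setIntegral_energyDensity B hU (hΦ.slice _) hC hCU]
  refine ((hderiv 1).fun_add (hderiv Complex.I)).congr_deriv ?_
  simp only [tension, map_add]
  rw [integral_add (hint 1) (hint Complex.I)]
  ring

end firstVariation

section variation

variable {A : Type*} [NormedRing A] {G : Subgroup Aˣ} [NormedAlgebra ℝ A] {h : G}
  {u : ℂ → SymSpace h}

theorem quotSmoothOn_variation {γ : ℝ → G} {U : Set ℂ} (hγ : SmoothOn γ univ)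
    (hU : IsOpen U) (hu : QuotSmoothOn u U) {φ : ℂ → ℝ} (hφ : ContDiff ℝ ∞ φ) :
    QuotSmoothOn (fun p : ℝ × ℂ => γ (p.1 * φ p.2) • u p.2) (univ ×ˢ U) :=
  (hu.comp (isOpen_univ.prod hU) contDiff_snd.contDiffOn fun _ hp => hp.2).smul
    (hγ.comp (f := fun p : ℝ × ℂ => p.1 * φ p.2) (by fun_prop) fun _ _ => mem_univ _)

theorem variationField_cartanEmbedding [CompleteSpace A] {γ : ℝ → G} {X : A} (hγ0 : γ 0 = 1)
    (hγX : HasDerivAt (fun t => mat (γ t)) X 0) (φ : ℂ → ℝ) (w : ℂ) :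
    variationField (fun t x => cartanEmbedding h (γ (t * φ x) • u x)) w =
      φ w • (mat (cartanEmbedding h (u w))⁻¹ * X * mat (cartanEmbedding h (u w)) - X) := by
  have hφ : HasDerivAt (fun t : ℝ => t * φ w) (φ w) 0 := by
    simpa using (hasDerivAt_id (0 : ℝ)).mul_const (φ w)
  have hγφ : HasDerivAt (fun t => mat (γ (t * φ w))) (φ w • X) 0 :=
    HasDerivAt.scomp (0 : ℝ) (g₁ := fun t => mat (γ t)) (by simpa using hγX) hφ
  have hconj := (hasDerivAt_conj (γ := fun t => γ (t * φ w)) (by simp [hγ0]) hγφ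
    (mat (cartanEmbedding h (u w)))).deriv
  simp only [variationField, cartanEmbedding_smul, mat_mul, hconj, zero_mul, hγ0, inv_one, one_mul,
    mul_one]
  simp only [mul_sub, smul_mul_assoc, mul_smul_comm, mat_inv_mul_cancel_left, smul_sub, mul_assoc]

end variation

section eulerLagrange

variable {A : Type*} [NormedRing A] {G : Subgroup Aˣ} [NormedAlgebra ℝ A] [FiniteDimensional ℝ A]
  (B : BiinvariantMetric G)

theorem harmonicOn_of_tension_eq_zero {u : ℂ → G} {U : Set ℂ} (hU : IsOpen U) (hu : SmoothOn u U)
    (h0 : ∀ w ∈ U, tension u w = 0) : HarmonicOn B u U := by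
  refine ⟨hu, fun Φ hΦ hΦ0 C hC hCU hΦC => ?_⟩
  have hderiv := hasDerivAt_setIntegral_energyDensity B hU hΦ hC hCU
    fun t w hw => by rw [hΦC t w hw, hΦ0 w hw.1]
  have hzero : ∫ w in C, extForm B (variationField Φ w) (tension (Φ 0) w) = 0 :=
    setIntegral_eq_zero_of_forall_eq_zero fun w hw => by
      rw [tension_congr hU hΦ0 (hCU hw), h0 w (hCU hw), map_zero]
  simpa only [hzero, neg_zero] using hderiv

variable {h : G} {u : ℂ → SymSpace h} {U : Set ℂ}

theorem quotHarmonicOn_of_harmonicOn (hsq : h * h = 1) (hU : IsOpen U)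
    (hu : QuotSmoothOn u U) (hH : HarmonicOn B (fun w => cartanEmbedding h (u w)) U) :
    QuotHarmonicOn B u U := by
  refine ⟨hu, fun Φ hΦ hΦ0 C hC hCU hΦC => ?_⟩
  have hcrit := hH.critical (fun t w => cartanEmbedding h (Φ t w)) hΦ.smoothOn
    (fun w hw => by rw [hΦ0 w hw]) C hC hCU (fun t w hw => by rw [hΦC t w hw])
  simp only [setIntegral_energyDensity_cartanEmbedding B hsq (hΦ.slice hU _)
    hC.measurableSet hCU] at hcrit
  simpa using hcrit.const_mul (1 / 4 : ℝ)

theorem integral_smul_extForm_tension_eq_zero (hsq : h * h = 1) (hU : IsOpen U)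
    (hu : QuotHarmonicOn B u U) {X : A} (hX : X ∈ lieAlg G) {φ : ℂ → ℝ} (hφ : ContDiff ℝ ∞ φ)
    (hφc : HasCompactSupport φ) (hφU : tsupport φ ⊆ U) :
    ∫ w, φ w • extForm B
      (mat (cartanEmbedding h (u w))⁻¹ * X * mat (cartanEmbedding h (u w)) - X)
      (tension (fun x => cartanEmbedding h (u x)) w) = 0 := by
  obtain ⟨γ, hγ, hγ0, hγX⟩ := hX
  have hφ0 : ∀ w ∉ tsupport φ, φ w = 0 := fun _ => image_eq_zero_of_notMem_tsupport
  have hΦ := quotSmoothOn_variation hγ hU hu.smooth hφ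
  have hcrit := (hu.critical (fun t x => γ (t * φ x) • u x) hΦ (fun w _ => by simp [hγ0])
    (tsupport φ) hφc hφU fun t w hw => by simp [hφ0 w hw.2, hγ0]).const_mul (4 : ℝ)
  simp only [← setIntegral_energyDensity_cartanEmbedding B hsq
    (QuotSmoothOn.slice (Φ := fun t x => γ (t * φ x) • u x) hU hΦ _) hφc.measurableSet hφU]
    at hcrit
  have hvar := (hasDerivAt_setIntegral_energyDensity B hU hΦ.smoothOn hφc hφU
    fun t w hw => by simp [hφ0 w hw.2, hγ0]).unique hcrit
  rw [← setIntegral_eq_integral_of_forall_compl_eq_zero (s := tsupport φ)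
    fun w hw => by simp [hφ0 w hw]]
  simpa [variationField_cartanEmbedding hγ0 hγX, hγ0] using hvar

theorem extForm_conj_sub_tension (hsq : h * h = 1) (hU : IsOpen U) (hu : QuotSmoothOn u U) {X : A}
    (hX : X ∈ lieAlg G) {w : ℂ} (hw : w ∈ U) :
    extForm B (mat (cartanEmbedding h (u w))⁻¹ * X * mat (cartanEmbedding h (u w)) - X)
      (tension (fun x => cartanEmbedding h (u x)) w) =
      -2 * extForm B X (tension (fun x => cartanEmbedding h (u x)) w) := by
  set c := cartanEmbedding h (u w)
  set T := tension (fun x => cartanEmbedding h (u x)) w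
  have hT : T ∈ lieAlg G := tension_mem hU hu.smoothOn hw
  have hconj : extForm B (mat c⁻¹ * X * mat c) T = -extForm B X T := by
    rw [← extForm_conj B c (by simpa using conj_mem_lieAlg c⁻¹ hX) hT,
      conj_tension_cartanEmbedding hsq hu hw]
    simp [mul_assoc, T]
  rw [map_sub, sub_apply, hconj]
  ring

theorem tension_eq_zero_of_quotHarmonicOn (hsq : h * h = 1) (hU : IsOpen U)
    (hu : QuotHarmonicOn B u U) {w : ℂ} (hw : w ∈ U) :
    tension (fun x => cartanEmbedding h (u x)) w = 0 := by
  set T := tension (fun x => cartanEmbedding h (u x))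
  refine eq_zero_of_extForm B (tension_mem hU hu.smooth.smoothOn hw) fun X hX => ?_
  have hcont : ContinuousOn (fun w => extForm B X (T w)) U :=
    (contDiffOn_extForm B contDiffOn_const (contDiffOn_tension hU hu.smooth.smoothOn)).continuousOn
  have hweak : ∀ φ : ℂ → ℝ, ContDiff ℝ ∞ φ → HasCompactSupport φ → tsupport φ ⊆ U →
      ∫ x, φ x • extForm B X (T x) = 0 := fun φ hφ hφc hφU => by
    have hcongr : ∀ x, φ x • extForm B X (T x) = (-1 / 2) * (φ x • extForm B
        (mat (cartanEmbedding h (u x))⁻¹ * X * mat (cartanEmbedding h (u x)) - X) (T x)) := by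
      intro x
      by_cases hx : x ∈ tsupport φ
      · rw [extForm_conj_sub_tension B hsq hU hu.smooth hX (hφU hx)]
        simp only [smul_eq_mul]
        ring
      · simp [image_eq_zero_of_notMem_tsupport hx]
    simp only [hcongr, integral_const_mul,
      integral_smul_extForm_tension_eq_zero B hsq hU hu hX hφ hφc hφU, T, mul_zero]
  have hae := hU.ae_eq_zero_of_integral_contDiff_smul_eq_zero (μ := volume)
    (hcont.locallyIntegrableOn hU.measurableSet) hweak
  exact Measure.eqOn_open_of_ae_eq (μ := (volume : Measure ℂ))
    ((ae_restrict_iff' hU.measurableSet).2 hae) hU hcont continuousOn_const hw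

theorem quotHarmonicOn_iff_tension_eq_zero (hsq : h * h = 1) (hU : IsOpen U)
    (hu : QuotSmoothOn u U) :
    QuotHarmonicOn B u U ↔ ∀ w ∈ U, tension (fun x => cartanEmbedding h (u x)) w = 0 :=
  ⟨fun hH _ hw => tension_eq_zero_of_quotHarmonicOn B hsq hU hH hw, fun h0 =>
    quotHarmonicOn_of_harmonicOn B hsq hU hu (harmonicOn_of_tension_eq_zero B hU hu.smoothOn h0)⟩

theorem quotHarmonicOn_iff_harmonicOn (hsq : h * h = 1) (hU : IsOpen U) (hu : QuotSmoothOn u U) :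
    QuotHarmonicOn B u U ↔ HarmonicOn B (fun w => cartanEmbedding h (u w)) U :=
  ⟨fun hH => harmonicOn_of_tension_eq_zero B hU hu.smoothOn
    ((quotHarmonicOn_iff_tension_eq_zero B hsq hU hu).1 hH),
    quotHarmonicOn_of_harmonicOn B hsq hU hu⟩

end eulerLagrange

section exponential

open NormedSpace Filter
open scoped Topology

variable {A : Type*} [NormedRing A] [NormedAlgebra ℝ A] [CompleteSpace A]

theorem contDiff_normedSpace_exp : ContDiff ℝ ω (exp : A → A) :=
  contDiff_iff_contDiffAt.2 fun X => (exp_analytic (𝕂 := ℝ) X).contDiffAt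

theorem exp_add_smul (X : A) (s t : ℝ) : exp ((s + t) • X) = exp (s • X) * exp (t • X) := by
  let _ : NormedAlgebra ℚ A := NormedAlgebra.restrictScalars ℚ ℝ A
  rw [add_smul]
  exact exp_add_of_commute (((Commute.refl X).smul_left s).smul_right t)

theorem exp_mul_exp_neg (X : A) : exp X * exp (-X) = 1 := by
  simpa using (exp_add_smul X 1 (-1)).symm

theorem exp_neg_mul_exp (X : A) : exp (-X) * exp X = 1 := by
  simpa using exp_mul_exp_neg (-X)

theorem exp_neg_eq_mat_inv {G : Subgroup Aˣ} {g : G} {X : A} (hg : mat g = exp X) :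
    exp (-X) = mat g⁻¹ := by
  rw [← mul_one (mat g⁻¹), ← exp_mul_exp_neg X, ← hg, mat_inv_mul_cancel_left]

theorem exp_mat_conj {G : Subgroup Aˣ} (g : G) (X : A) :
    exp (mat g * X * mat g⁻¹) = mat g * exp X * mat g⁻¹ :=
  let _ : NormedAlgebra ℚ A := NormedAlgebra.restrictScalars ℚ ℝ A
  exp_units_conj (g : Aˣ) X

theorem hasStrictFDerivAt_exp_zero_refl :
    HasStrictFDerivAt (exp : A → A) (ContinuousLinearEquiv.refl ℝ A : A →L[ℝ] A) 0 :=
  hasStrictFDerivAt_exp_zero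

theorem hasStrictFDerivAt_exp_mul_exp (π : A →L[ℝ] A) :
    HasStrictFDerivAt (fun Z => exp (π Z) * exp (Z - π Z))
      (ContinuousLinearEquiv.refl ℝ A : A →L[ℝ] A) 0 := by
  have hπ : HasStrictFDerivAt (fun Z => exp (π Z)) ((1 : A →L[ℝ] A).comp π) 0 :=
    HasStrictFDerivAt.comp (g := exp) (0 : A)
      (by simpa using hasStrictFDerivAt_exp_zero (𝕂 := ℝ) (𝔸 := A)) π.hasStrictFDerivAt
  have hsub : HasStrictFDerivAt (fun Z => exp (Z - π Z))
      ((1 : A →L[ℝ] A).comp (ContinuousLinearMap.id ℝ A - π)) 0 :=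
    HasStrictFDerivAt.comp (g := exp) (0 : A)
      (by simpa using hasStrictFDerivAt_exp_zero (𝕂 := ℝ) (𝔸 := A))
      ((hasStrictFDerivAt_id (0 : A)).sub π.hasStrictFDerivAt)
  refine (hπ.mul' hsub).congr_fderiv ?_
  ext Z
  simp

/-- The inverse of the exponential map near the identity, provided by the inverse function
theorem; its values away from the identity are arbitrary. -/
def localLog : A → A :=
  (hasStrictFDerivAt_exp_zero_refl (A := A)).localInverse exp _ 0

theorem eventually_localLog_exp : ∀ᶠ X in 𝓝 (0 : A), localLog (exp X) = X :=
  hasStrictFDerivAt_exp_zero_refl.eventually_left_inverse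

theorem eventually_exp_localLog : ∀ᶠ a in 𝓝 (1 : A), exp (localLog a) = a :=
  exp_zero (𝔸 := A) ▸ hasStrictFDerivAt_exp_zero_refl.eventually_right_inverse

theorem localLog_one : localLog (1 : A) = 0 := by
  simpa using (eventually_localLog_exp (A := A)).self_of_nhds

theorem hasFDerivAt_localLog : HasFDerivAt localLog (ContinuousLinearMap.id ℝ A) 1 := by
  have h := (hasStrictFDerivAt_exp_zero_refl (A := A)).to_localInverse.hasFDerivAt
  rwa [exp_zero] at h

theorem eventually_contDiffAt_localLog : ∀ᶠ a in 𝓝 (1 : A), ContDiffAt ℝ ω localLog a := by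
  have hexp : ContDiffAt ℝ ω (exp : A → A) 0 := contDiff_normedSpace_exp.contDiffAt
  have h := hexp.to_localInverse hasStrictFDerivAt_exp_zero_refl.hasFDerivAt (by simp)
  rw [exp_zero] at h
  exact h.eventually (by simp)

theorem tendsto_localLog : Tendsto localLog (𝓝 (1 : A)) (𝓝 0) := by
  have h := (hasFDerivAt_localLog (A := A)).continuousAt.tendsto
  rwa [localLog_one] at h

end exponential

section closedSubgroup

open NormedSpace Filter
open scoped Topology

variable {A : Type*} [NormedRing A] {G : Subgroup Aˣ} [NormedAlgebra ℝ A]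

theorem exp_neg_mem [CompleteSpace A] {X : A} (hX : exp X ∈ range (mat : G → A)) :
    exp (-X) ∈ range (mat : G → A) := by
  obtain ⟨g, hg⟩ := hX
  exact ⟨g⁻¹, (exp_neg_eq_mat_inv hg).symm⟩

theorem exp_nsmul_mem [CompleteSpace A] {X : A} (hX : exp X ∈ range (mat : G → A)) (n : ℕ) :
    exp (n • X) ∈ range (mat : G → A) := by
  let _ : NormedAlgebra ℚ A := NormedAlgebra.restrictScalars ℚ ℝ A
  obtain ⟨g, hg⟩ := hX
  exact ⟨g ^ n, by rw [exp_nsmul, ← hg]; simp [mat]⟩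

theorem exp_mem_of_tendsto [CompleteSpace A] (hG : IsClosed (G : Set Aˣ)) {α : Type*}
    {l : Filter α} [NeBot l] {f : α → A} {X : A} (hf : Tendsto f l (𝓝 (exp X)))
    (hm : ∀ᶠ a in l, f a ∈ range (mat : G → A)) : exp X ∈ range (mat : G → A) := by
  have hrange : range (mat : G → A) = Units.val '' (G : Set Aˣ) := by
    ext a
    simp [mat]
  let expX : Aˣ := ⟨exp X, exp (-X), exp_mul_exp_neg X, exp_neg_mul_exp X⟩
  have hclosure : expX ∈ closure (G : Set Aˣ) := by
    rw [(Units.isOpenEmbedding_val (R := A)).isEmbedding.closure_eq_preimage_closure_image,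
      ← hrange]
    exact mem_closure_of_tendsto hf hm
  exact ⟨⟨expX, by rwa [hG.closure_eq] at hclosure⟩, rfl⟩

theorem tendsto_floor_nsmul {E : Type*} [NormedAddCommGroup E] [NormedSpace ℝ E] {α : Type*}
    {l : Filter α} {Y : α → E} {r : α → ℝ} {X : E} (hY : Tendsto Y l (𝓝 0))
    (hr : ∀ᶠ a in l, 0 ≤ r a) (hrY : Tendsto (fun a => r a • Y a) l (𝓝 X)) :
    Tendsto (fun a => ⌊r a⌋₊ • Y a) l (𝓝 X) := by
  have hfract : Tendsto (fun a => (r a - ⌊r a⌋₊) • Y a) l (𝓝 0) := by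
    refine squeeze_zero_norm' ?_ (tendsto_zero_iff_norm_tendsto_zero.1 hY)
    filter_upwards [hr] with a ha
    rw [norm_smul, Real.norm_eq_abs]
    refine mul_le_of_le_one_left (norm_nonneg _) (abs_le.2 ⟨?_, ?_⟩) <;>
      linarith [Nat.floor_le ha, Nat.lt_floor_add_one (r a)]
  refine (sub_zero X ▸ hrY.sub hfract).congr fun a => ?_
  rw [← sub_smul, sub_sub_cancel, Nat.cast_smul_eq_nsmul]

theorem exp_mem_of_tendsto_smul [CompleteSpace A] (hG : IsClosed (G : Set Aˣ)) {α : Type*}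
    {l : Filter α} [NeBot l] {Y : α → A} {r : α → ℝ} {X : A} (hY : Tendsto Y l (𝓝 0))
    (hm : ∀ᶠ a in l, exp (Y a) ∈ range (mat : G → A)) (hr : ∀ᶠ a in l, 0 ≤ r a)
    (hrY : Tendsto (fun a => r a • Y a) l (𝓝 X)) : exp X ∈ range (mat : G → A) :=
  exp_mem_of_tendsto hG
    ((contDiff_normedSpace_exp.continuous.tendsto X).comp (tendsto_floor_nsmul hY hr hrY))
    (hm.mono fun _ ha => exp_nsmul_mem ha _)

variable [FiniteDimensional ℝ A]

theorem mem_lieAlg_of_forall_exp_mem {X : A}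
    (h : ∀ t : ℝ, exp (t • X) ∈ range (mat : G → A)) : X ∈ lieAlg G := by
  choose γ hγ using h
  refine ⟨γ, ?_, ?_, ?_⟩
  · have hexp : ContDiff ℝ ∞ fun t : ℝ => exp (t • X) :=
      (contDiff_normedSpace_exp.of_le le_top).comp (contDiff_id.smul contDiff_const)
    simpa only [SmoothOn, hγ] using hexp.contDiffOn
  · exact mat_injective (by simp [hγ])
  · simp only [hγ]
    simpa using hasDerivAt_exp_smul_const (𝕂 := ℝ) X 0

theorem exp_mem_of_mem_lieAlg (hG : IsClosed (G : Set Aˣ)) {X : A}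
    (hX : X ∈ lieAlg G) : exp X ∈ range (mat : G → A) := by
  obtain ⟨γ, -, hγ0, hγX⟩ := hX
  have hmat0 : mat (γ 0) = 1 := by simp [hγ0]
  have hγ : Tendsto (fun t => mat (γ t)) (𝓝 0) (𝓝 1) := hmat0 ▸ hγX.continuousAt.tendsto
  have hlog : HasDerivAt (fun t => localLog (mat (γ t))) X 0 :=
    HasFDerivAt.comp_hasDerivAt (l := localLog) (l' := ContinuousLinearMap.id ℝ A) (0 : ℝ)
      (hmat0 ▸ hasFDerivAt_localLog) hγX
  have hslope := (hasDerivAt_iff_tendsto_slope_zero.1 hlog).mono_left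
    (nhdsWithin_mono (0 : ℝ) (show Ioi (0 : ℝ) ⊆ {0}ᶜ from fun t ht => ne_of_gt ht))
  refine exp_mem_of_tendsto_smul hG (l := 𝓝[>] (0 : ℝ)) (r := fun t => t⁻¹)
    ((tendsto_localLog.comp hγ).mono_left nhdsWithin_le_nhds) ?_ ?_
    (by simpa [hmat0, localLog_one] using hslope)
  · filter_upwards [(hγ.eventually eventually_exp_localLog).filter_mono nhdsWithin_le_nhds]
      with t ht
    exact ⟨γ t, ht.symm⟩
  · filter_upwards [self_mem_nhdsWithin] with t ht
    exact inv_nonneg.2 (le_of_lt ht)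

theorem eventually_eq_zero_of_exp_mem (hG : IsClosed (G : Set Aˣ)) {W : Submodule ℝ A}
    (hW : Disjoint (lieAlg G).toSubmodule W) :
    ∀ᶠ Y in 𝓝 (0 : A), Y ∈ W → exp Y ∈ range (mat : G → A) → Y = 0 := by
  have : ProperSpace A := FiniteDimensional.proper ℝ A
  by_contra hcon
  obtain ⟨Y, hY0, hY⟩ := exists_seq_forall_of_frequently (not_eventually.1 hcon)
  simp only [Classical.not_imp] at hY
  obtain ⟨y, hy, φ, hφ, hlim⟩ := (isCompact_sphere (0 : A) 1).tendsto_subseq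
    (x := fun n => ‖Y n‖⁻¹ • Y n) fun n => by simp [norm_smul, (hY n).2.2]
  have hyW : y ∈ W := W.closed_of_finiteDimensional.mem_of_tendsto hlim
    (Eventually.of_forall fun n => W.smul_mem _ (hY (φ n)).1)
  have hexp : ∀ t : ℝ, 0 ≤ t → exp (t • y) ∈ range (mat : G → A) := fun t ht =>
    exp_mem_of_tendsto_smul hG (r := fun n => t * ‖Y (φ n)‖⁻¹) (hY0.comp hφ.tendsto_atTop)
      (Eventually.of_forall fun n => (hY (φ n)).2.1) (Eventually.of_forall fun n => by positivity)
      (by simpa only [mul_smul, Function.comp_apply] using! hlim.const_smul t)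
  have hyG : y ∈ lieAlg G := mem_lieAlg_of_forall_exp_mem fun t => by
    rcases le_total 0 t with ht | ht
    · exact hexp t ht
    · simpa using exp_neg_mem (hexp (-t) (by linarith))
  simp [Submodule.disjoint_def.1 hW y hyG hyW] at hy

/- In the coordinates `Z ↦ exp (π Z) * exp (Z - π Z)` around the identity, an element of `G` has
trivial second factor. -/
theorem eventually_localLog_mem_lieAlg (hG : IsClosed (G : Set Aˣ)) :
    ∀ᶠ a in 𝓝 (1 : A), a ∈ range (mat : G → A) → localLog a ∈ lieAlg G := by
  obtain ⟨π, hπ⟩ : ∃ π : A →L[ℝ] A, ∀ Z, π Z = lieProj G Z :=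
    ⟨((lieAlg G).toSubmodule.subtype ∘ₗ lieProj G).toContinuousLinearMap, fun _ => rfl⟩
  have hπG : ∀ Z, π Z ∈ lieAlg G := fun Z => hπ Z ▸ (lieProj G Z).2
  have hdisj : Disjoint (lieAlg G).toSubmodule (LinearMap.ker π.toLinearMap) := by
    refine Submodule.disjoint_def.2 fun X hX hX0 => ?_
    rw [LinearMap.mem_ker] at hX0
    simpa [hπ, lieProj_of_mem hX] using hX0
  have hmap := (hasStrictFDerivAt_exp_mul_exp π).map_nhds_eq_of_equiv
  simp only [map_zero, sub_zero, exp_zero, mul_one] at hmap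
  rw [← hmap, eventually_map]
  have hπ0 : Tendsto π (𝓝 0) (𝓝 0) := by
    simpa using π.continuous.tendsto 0
  have hsub0 : Tendsto (fun Z => Z - π Z) (𝓝 0) (𝓝 0) := by
    simpa using tendsto_id.sub hπ0
  filter_upwards [hsub0.eventually (eventually_eq_zero_of_exp_mem hG hdisj),
    hπ0.eventually eventually_localLog_exp] with Z hZ hlog
  rintro ⟨g, hg⟩
  obtain ⟨k, hk⟩ := exp_mem_of_mem_lieAlg hG (hπG Z)
  have hexp : exp (Z - π Z) = mat (k⁻¹ * g) := by
    rw [mat_mul, hg, ← hk, mat_inv_mul_cancel_left]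
  have hker : Z - π Z ∈ LinearMap.ker π.toLinearMap := by
    simp [hπ, lieProj_of_mem (lieProj G Z).2]
  rw [hZ hker ⟨_, hexp.symm⟩, exp_zero, mul_one, hlog]
  exact hπG Z

end closedSubgroup

section localLift

open NormedSpace Filter
open scoped Topology

variable {A : Type*} [NormedRing A] {G : Subgroup Aˣ}

theorem mul_eq_conj_of_sqrt {Γ : Type*} [Group Γ] {h f g k : Γ} (hsq : h * h = 1)
    (hkk : k * k = g⁻¹ * f * g * h) (hk : h * k * h⁻¹ = k⁻¹) : f = (g * k) * h * (g * k)⁻¹ := by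
  have hkh : h * k⁻¹ = k * h := by
    rw [← hk, inv_eq_of_mul_eq_one_left hsq]
    simp [← mul_assoc, hsq]
  calc f = g * (g⁻¹ * f * g * h) * h * g⁻¹ := by simp [mul_assoc, hsq]
    _ = g * k * (k * h) * g⁻¹ := by rw [← hkk]; simp only [mul_assoc]
    _ = (g * k) * h * (g * k)⁻¹ := by rw [← hkh]; simp only [mul_assoc, mul_inv_rev]

theorem conj_eq_inv_of_mem_conjClass {h f : G} (hsq : h * h = 1) (hf : f ∈ conjClass h) (g : G) :
    h * (g⁻¹ * f * g * h) * h⁻¹ = (g⁻¹ * f * g * h)⁻¹ := by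
  obtain ⟨c, rfl⟩ := hf
  have hinv : h⁻¹ = h := inv_eq_of_mul_eq_one_left hsq
  simp [mul_assoc, hinv, hsq]

variable [NormedAlgebra ℝ A]

theorem eventually_conj_localLog [CompleteSpace A] (h : G) :
    ∀ᶠ a in 𝓝 (1 : A), ∀ g : G, mat g = a → h * g * h⁻¹ = g⁻¹ →
      mat h * localLog a * mat h⁻¹ = -localLog a := by
  have hneg : Tendsto (fun a : A => -localLog a) (𝓝 1) (𝓝 0) := by
    simpa using (tendsto_localLog (A := A)).neg
  have hconj : Tendsto (fun a : A => mat h * localLog a * mat h⁻¹) (𝓝 1) (𝓝 0) := by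
    simpa using (tendsto_localLog.const_mul (mat h)).mul_const (mat h⁻¹)
  filter_upwards [eventually_exp_localLog, hneg.eventually eventually_localLog_exp,
    hconj.eventually eventually_localLog_exp] with a hexp hneg hconj g hg hgh
  rw [← hconj, ← hneg, exp_mat_conj, hexp, exp_neg_eq_mat_inv (hg.trans hexp.symm), ← hgh,
    mat_mul, mat_mul, hg]

theorem eventually_exists_sqrt [FiniteDimensional ℝ A] (hG : IsClosed (G : Set Aˣ)) (h : G) :
    ∀ᶠ a in 𝓝 (1 : A), ∀ g : G, mat g = a → h * g * h⁻¹ = g⁻¹ →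
      ∃ k : G, mat k = exp ((1 / 2 : ℝ) • localLog a) ∧ k * k = g ∧ h * k * h⁻¹ = k⁻¹ := by
  filter_upwards [eventually_exp_localLog, eventually_localLog_mem_lieAlg hG,
    eventually_conj_localLog h] with a hexp hmem hconj g hg hgh
  obtain ⟨k, hk⟩ := exp_mem_of_mem_lieAlg hG ((lieAlg G).smul_mem (1 / 2 : ℝ) (hmem ⟨g, hg⟩))
  refine ⟨k, hk, mat_injective ?_, mat_injective ?_⟩
  · rw [mat_mul, hk, ← exp_add_smul, hg]
    norm_num [hexp]
  · rw [mat_mul, mat_mul, hk, ← exp_mat_conj, mul_smul_comm, smul_mul_assoc, hconj g hg hgh,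
      smul_neg, exp_neg_eq_mat_inv hk]

variable {E : Type*} [NormedAddCommGroup E] [NormedSpace ℝ E] [FiniteDimensional ℝ A]

/- With `f w₀ = g₀ h g₀⁻¹`, the map `a = g₀⁻¹ f g₀ h` is close to the identity and inverted by
conjugation with `h`; so is its square root `k`, and `f = (g₀ k) h (g₀ k)⁻¹`. -/
theorem exists_local_lift_conj (hG : IsClosed (G : Set Aˣ)) {h : G} (hsq : h * h = 1) {f : E → G}
    {U : Set E} (hU : IsOpen U) (hf : SmoothOn f U) (hconj : ∀ w ∈ U, f w ∈ conjClass h) {w₀ : E}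
    (hw₀ : w₀ ∈ U) :
    ∃ V : Set E, IsOpen V ∧ w₀ ∈ V ∧ ∃ F : E → G, SmoothOn F V ∧
      ∀ w ∈ V, f w = F w * h * (F w)⁻¹ := by
  obtain ⟨g₀, hg₀⟩ := hconj w₀ hw₀
  let a : E → G := fun w => g₀⁻¹ * f w * g₀ * h
  have ha : SmoothOn a U := (((smoothOn_const g₀⁻¹ U).mul hf).mul (smoothOn_const g₀ U)).mul
    (smoothOn_const h U)
  have ha1 : Tendsto (fun w => mat (a w)) (𝓝 w₀) (𝓝 1) := by
    have haw₀ : a w₀ = 1 := by simp [a, hg₀, mul_assoc, hsq]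
    have hcont := (ha.differentiableAt hU hw₀).continuousAt.tendsto
    rwa [haw₀, mat_one] at hcont
  have hev : ∀ᶠ w in 𝓝 w₀, w ∈ U ∧ ContDiffAt ℝ ω localLog (mat (a w)) ∧
      ∃ k : G, mat k = exp ((1 / 2 : ℝ) • localLog (mat (a w))) ∧ k * k = a w ∧
        h * k * h⁻¹ = k⁻¹ := by
    filter_upwards [hU.mem_nhds hw₀, ha1.eventually eventually_contDiffAt_localLog,
      ha1.eventually (eventually_exists_sqrt hG h)] with w hwU hlog hsqrt
    exact ⟨hwU, hlog, hsqrt _ rfl (conj_eq_inv_of_mem_conjClass hsq (hconj w hwU) g₀)⟩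
  obtain ⟨V, hV, hVo, hw₀V⟩ := eventually_nhds_iff.1 hev
  choose! k hk hkk hkh using fun w (hw : w ∈ V) => (hV w hw).2.2
  have hks : SmoothOn k V := fun w hw => by
    have hlog : ContDiffAt ℝ ∞ (fun w => localLog (mat (a w))) w :=
      ((hV w hw).2.1.of_le le_top).comp w (ha.contDiffAt hU (hV w hw).1)
    exact (((contDiff_normedSpace_exp.of_le le_top).contDiffAt.comp w
      (hlog.const_smul (1 / 2 : ℝ))).contDiffWithinAt).congr hk (hk w hw)
  exact ⟨V, hVo, hw₀V, fun w => g₀ * k w, (smoothOn_const g₀ V).mul hks,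
    fun w hw => mul_eq_conj_of_sqrt hsq (hkk w hw) (hkh w hw)⟩

theorem quotSmoothOn_of_smoothOn (hG : IsClosed (G : Set Aˣ)) {h : G} (hsq : h * h = 1)
    {u : E → SymSpace h} {U : Set E} (hU : IsOpen U)
    (hu : SmoothOn (fun w => cartanEmbedding h (u w)) U) : QuotSmoothOn u U := fun w hw => by
  have hconj : ∀ x ∈ U, cartanEmbedding h (u x) ∈ conjClass h := fun x _ => by
    induction u x using QuotientGroup.induction_on with | H g => exact ⟨g, rfl⟩
  obtain ⟨V, hV, hwV, F, hF, hFu⟩ := exists_local_lift_conj hG hsq hU hu hconj hw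
  exact ⟨V, hV, hwV, F, hF, fun x hx => cartanEmbedding_injective h (hFu x hx)⟩

end localLift

section holomorphicChange

variable {X : Type*} [NormedAddCommGroup X] [NormedSpace ℝ X]

theorem apply_apply_add_apply_mul_I (Q : ℂ →L[ℝ] ℂ →L[ℝ] X) (c : ℂ) :
    Q c c + Q (c * Complex.I) (c * Complex.I) =
      Complex.normSq c • (Q 1 1 + Q Complex.I Complex.I) := by
  rw [map_eq_re_smul_add_im_smul Q c, map_eq_re_smul_add_im_smul Q (c * Complex.I)]
  simp only [add_apply, smul_apply]
  rw [map_eq_re_smul_add_im_smul (Q 1) c, map_eq_re_smul_add_im_smul (Q 1) (c * Complex.I),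
    map_eq_re_smul_add_im_smul (Q Complex.I) c,
    map_eq_re_smul_add_im_smul (Q Complex.I) (c * Complex.I)]
  simp only [Complex.mul_re, Complex.mul_im, Complex.I_re, Complex.I_im, Complex.normSq_apply]
  module

theorem fderiv_pullback_apply {a : ℂ → ℂ →L[ℝ] X} {φ ψ : ℂ → ℂ} {w ψ' : ℂ}
    (ha : DifferentiableAt ℝ a (φ w)) (hφ : HasDerivAt φ (ψ w) w) (hψ : HasDerivAt ψ ψ' w) (v : ℂ) :
    fderiv ℝ (fun x => a (φ x) (ψ x * v)) w v =
      fderiv ℝ a (φ w) (ψ w * v) (ψ w * v) + a (φ w) (ψ' * v * v) := by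
  have haφ := ha.hasFDerivAt.comp w hφ.complexToReal_fderiv
  have h := haφ.clm_apply (hψ.mul_const v).complexToReal_fderiv
  rw [HasFDerivAt.fderiv (f := fun x => a (φ x) (ψ x * v)) h]
  simp [add_comm]

variable {A : Type*} [NormedRing A] {G : Subgroup Aˣ} [NormedAlgebra ℝ A]
  {E : Type*} [NormedAddCommGroup E] [NormedSpace ℝ E]

/-- The Maurer-Cartan form of `F` as a map into continuous linear forms. -/
def maurerCartanForm (F : E → G) (w : E) : E →L[ℝ] A :=
  (ContinuousLinearMap.mul ℝ A (mat (F w)⁻¹)).comp (fderiv ℝ (fun x => mat (F x)) w)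

theorem maurerCartanForm_apply (F : E → G) (w v : E) :
    maurerCartanForm F w v = maurerCartan F w v := rfl

theorem maurerCartan_comp {u : ℂ → G} {U : Set ℂ} (hU : IsOpen U) (hu : SmoothOn u U) {φ : ℂ → ℂ}
    {w c : ℂ} (hw : φ w ∈ U) (hφ : HasDerivAt φ c w) (v : ℂ) :
    maurerCartan (fun x => u (φ x)) w v = maurerCartan u (φ w) (c * v) := by
  have h := (hu.differentiableAt hU hw).hasFDerivAt.comp w hφ.complexToReal_fderiv
  rw [maurerCartan, HasFDerivAt.fderiv (f := fun x => mat (u (φ x))) h, maurerCartan]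
  simp

variable [CompleteSpace A]

theorem differentiableAt_maurerCartanForm {F : E → G} {V : Set E} (hV : IsOpen V)
    (hF : SmoothOn F V) {w : E} (hw : w ∈ V) : DifferentiableAt ℝ (maurerCartanForm F) w := by
  have hinv := (ContinuousLinearMap.mul ℝ A).differentiableAt.comp w
    (hF.inv.differentiableAt hV hw)
  have hd : DifferentiableAt ℝ (fderiv ℝ (fun x => mat (F x))) w :=
    ((hF.contDiffAt hV hw).fderiv_right (m := ∞) (by simp)).differentiableAt (by simp)
  exact hinv.clm_comp hd

theorem tension_comp {u : ℂ → G} {U W : Set ℂ} (hU : IsOpen U) (hW : IsOpen W)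
    (hu : SmoothOn u U) {φ : ℂ → ℂ} (hφ : DifferentiableOn ℂ φ W) (hm : MapsTo φ W U) {w : ℂ}
    (hw : w ∈ W) :
    tension (fun x => u (φ x)) w = Complex.normSq (deriv φ w) • tension u (φ w) := by
  have hd : ∀ x ∈ W, HasDerivAt φ (deriv φ x) x := fun x hx =>
    (hφ.differentiableAt (hW.mem_nhds hx)).hasDerivAt
  have hdd : HasDerivAt (deriv φ) (deriv (deriv φ) w) w :=
    ((hφ.deriv hW).differentiableAt (hW.mem_nhds hw)).hasDerivAt
  have ha := differentiableAt_maurerCartanForm hU hu (hm hw)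
  have hpull : ∀ v : ℂ, fderiv ℝ (fun x => maurerCartan (fun x => u (φ x)) x v) w v =
      fderiv ℝ (maurerCartanForm u) (φ w) (deriv φ w * v) (deriv φ w * v) +
        maurerCartanForm u (φ w) (deriv (deriv φ) w * v * v) := by
    intro v
    have hα : (fun x => maurerCartan (fun x => u (φ x)) x v) =ᶠ[nhds w]
        fun x => maurerCartanForm u (φ x) (deriv φ x * v) := by
      filter_upwards [hW.mem_nhds hw] with x hx using maurerCartan_comp hU hu (hm hx) (hd x hx) v
    rw [hα.fderiv_eq, fderiv_pullback_apply ha (hd w hw) hdd]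
  have hform : ∀ v : ℂ, fderiv ℝ (fun x => maurerCartan u x v) (φ w) v =
      fderiv ℝ (maurerCartanForm u) (φ w) v v := fun v => by
    simp only [← maurerCartanForm_apply]
    rw [fderiv_clm_apply ha (differentiableAt_const v)]
    simp
  have hI : deriv (deriv φ) w * Complex.I * Complex.I = -(deriv (deriv φ) w * 1 * 1) := by
    rw [mul_assoc, Complex.I_mul_I]
    ring
  rw [tension, tension, hpull, hpull, hform, hform, ← apply_apply_add_apply_mul_I, hI, map_neg,
    mul_one (deriv φ w)]
  abel

end holomorphicChange

section associatedFamily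

variable {A : Type*} [NormedRing A] {G : Subgroup Aˣ} [NormedAlgebra ℝ A]

/-- The real part `ℂ ⊗ A → A` of the complexification, a left inverse of `complexify`. -/
def realPart : ℂ ⊗[ℝ] A →ₗ[ℝ] A :=
  TensorProduct.lift ((LinearMap.lsmul ℝ A).comp Complex.reLm)

theorem realPart_smul_complexify (z : ℂ) (X : A) : realPart (z • complexify X) = z.re • X := by
  simp [realPart, complexify, TensorProduct.smul_tmul']

theorem realPart_complexify (X : A) : realPart (complexify X) = X := by
  simpa using realPart_smul_complexify 1 X

theorem eq_of_frame_equation {X K : A} {α : ℂ → A} {l : Circle} {v : ℂ}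
    (e : complexify X = (l : ℂ)⁻¹ • part10 α v + complexify K + (l : ℂ) • part01 α v) :
    X = K + ((l : ℂ).re • α v - (l : ℂ).im • α (Complex.I * v)) := by
  have hl : (l : ℂ)⁻¹ = (starRingEnd ℂ) (l : ℂ) := by
    rw [← Circle.coe_inv, Circle.coe_inv_eq_conj]
  have hre := congrArg realPart e
  simp only [hl, part10, part01, smul_sub, smul_add, smul_smul, map_add, map_sub,
    realPart_smul_complexify, realPart_complexify] at hre
  rw [hre]
  simp
  module

variable {E : Type*} [NormedAddCommGroup E] [NormedSpace ℝ E]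

theorem covDeriv_neg_right (h : G) (F : E → G) (w v v' : E) :
    covDeriv h F w v (-v') = -covDeriv h F w v v' := by
  have hneg : ∀ x, pPart h (maurerCartan F x (-v')) = -pPart h (maurerCartan F x v') := fun x => by
    rw [← maurerCartanForm_apply, map_neg, ← pPartCLM_apply, map_neg, pPartCLM_apply,
      maurerCartanForm_apply]
  simp only [covDeriv, hneg, fderiv_fun_neg, neg_apply, mul_neg, neg_mul]
  abel

variable [CompleteSpace A] {h : G}

theorem covDeriv_comm {F : E → G} {V : Set E} {w : E} (hV : IsOpen V) (hF : SmoothOn F V)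
    (hw : w ∈ V) (v v' : E) : covDeriv h F w v v' = covDeriv h F w v' v := by
  have hMC := congrArg (pPart h) (fderiv_maurerCartan_sub_fderiv_maurerCartan hV hF hw v' v)
  have hd : ∀ a b : E, fderiv ℝ (fun x => pPart h (maurerCartan F x a)) w b =
      pPart h (fderiv ℝ (fun x => maurerCartan F x a) w b) := fun a b => by
    rw [(hasFDerivAt_pPart_maurerCartan hV hF hw a).fderiv, ContinuousLinearMap.comp_apply,
      pPartCLM_apply]
  rw [pPart_sub, pPart_sub, pPart_mul, pPart_mul, ← hd, ← hd, sub_eq_iff_eq_add] at hMC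
  rw [covDeriv, covDeriv, hMC]
  abel

theorem covDeriv_frame {F H : ℂ → G} {V : Set ℂ} {w : ℂ} (hsq : h * h = 1) (hV : IsOpen V)
    (hF : SmoothOn F V) (hw : w ∈ V) {c s : ℝ}
    (hH : ∀ x ∈ V, ∀ v : ℂ, maurerCartan H x v = kPart h (maurerCartan F x v) +
      (c • pPart h (maurerCartan F x v) - s • pPart h (maurerCartan F x (Complex.I * v))))
    (v v' : ℂ) : covDeriv h H w v v' =
      c • covDeriv h F w v v' - s • covDeriv h F w v (Complex.I * v') := by
  have hp : ∀ x ∈ V, ∀ v : ℂ, pPart h (maurerCartan H x v) =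
      c • pPart h (maurerCartan F x v) - s • pPart h (maurerCartan F x (Complex.I * v)) := by
    intro x hx v
    rw [hH x hx v, pPart_add, pPart_sub, pPart_smul, pPart_smul, pPart_kPart hsq, pPart_pPart hsq,
      pPart_pPart hsq, zero_add]
  have hk : kPart h (maurerCartan H w v) = kPart h (maurerCartan F w v) := by
    rw [kPart_eq_sub, hp w hw, hH w hw, add_sub_cancel_right]
  have hd : fderiv ℝ (fun x => pPart h (maurerCartan H x v')) w =
      c • fderiv ℝ (fun x => pPart h (maurerCartan F x v')) w -
        s • fderiv ℝ (fun x => pPart h (maurerCartan F x (Complex.I * v'))) w := by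
    have hpv : (fun x => pPart h (maurerCartan H x v')) =ᶠ[nhds w] fun x =>
        c • pPart h (maurerCartan F x v') - s • pPart h (maurerCartan F x (Complex.I * v')) := by
      filter_upwards [hV.mem_nhds hw] with x hx using hp x hx v'
    have hd := fun a => (hasFDerivAt_pPart_maurerCartan (h := h) hV hF hw a).differentiableAt
    rw [hpv.fderiv_eq, fderiv_fun_sub ((hd _).fun_const_smul c) ((hd _).fun_const_smul s),
      fderiv_fun_const_smul (hd _), fderiv_fun_const_smul (hd _)]
  simp only [covDeriv, hd, hp w hw, hk, sub_apply, smul_apply, mul_sub, sub_mul, mul_smul_comm,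
    smul_mul_assoc]
  module

theorem covariantDivergence_frame {F H : ℂ → G} {V : Set ℂ} {w : ℂ} (hsq : h * h = 1)
    (hV : IsOpen V) (hF : SmoothOn F V) (hw : w ∈ V) {c s : ℝ}
    (hH : ∀ x ∈ V, ∀ v : ℂ, maurerCartan H x v = kPart h (maurerCartan F x v) +
      (c • pPart h (maurerCartan F x v) - s • pPart h (maurerCartan F x (Complex.I * v)))) :
    covariantDivergence h H w = c • covariantDivergence h F w := by
  rw [covariantDivergence, covDeriv_frame hsq hV hF hw hH, covDeriv_frame hsq hV hF hw hH,
    Complex.I_mul_I, covDeriv_neg_right, mul_one, covDeriv_comm hV hF hw 1 Complex.I,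
    covariantDivergence]
  module

end associatedFamily

section harmonicComp

variable {A : Type*} [NormedRing A] {G : Subgroup Aˣ} [NormedAlgebra ℝ A] [FiniteDimensional ℝ A]
  {B : BiinvariantMetric G} {h : G} {u : ℂ → SymSpace h} {U : Set ℂ}

theorem QuotHarmonicOn.comp (hsq : h * h = 1) (hU : IsOpen U) (hu : QuotHarmonicOn B u U)
    {φ : ℂ → ℂ} {W : Set ℂ} (hW : IsOpen W) (hφ : DifferentiableOn ℂ φ W) (hm : MapsTo φ W U) :
    QuotHarmonicOn B (fun x => u (φ x)) W := by
  have hφ' : ContDiffOn ℝ ∞ φ W := (hφ.contDiffOn hW).restrict_scalars ℝ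
  refine (quotHarmonicOn_iff_tension_eq_zero B hsq hW (hu.smooth.comp hW hφ' hm)).2 fun w hw => ?_
  rw [tension_comp hU hW hu.smooth.smoothOn hφ hm hw,
    tension_eq_zero_of_quotHarmonicOn B hsq hU hu (hm hw), smul_zero]

/- Being a critical point is not a pointwise condition, but the Euler-Lagrange equation is. -/
theorem quotHarmonicOn_of_forall_exists (hsq : h * h = 1) (hU : IsOpen U)
    (hu : ∀ w ∈ U, ∃ W, IsOpen W ∧ w ∈ W ∧ ∃ u', QuotHarmonicOn B u' W ∧ ∀ x ∈ W, u x = u' x) :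
    QuotHarmonicOn B u U := by
  have hsmooth : QuotSmoothOn u U := fun w hw => by
    obtain ⟨W, hW, hwW, u', hu', huu'⟩ := hu w hw
    obtain ⟨V, hV, hwV, F, hF⟩ := hu'.smooth w hwW
    exact ⟨V ∩ W, hV.inter hW, ⟨hwV, hwW⟩, F, hF.1.mono inter_subset_left, fun x hx =>
      (huu' x hx.2).trans (hF.2 x hx.1)⟩
  refine (quotHarmonicOn_iff_tension_eq_zero B hsq hU hsmooth).2 fun w hw => ?_
  obtain ⟨W, hW, hwW, u', hu', huu'⟩ := hu w hw
  rw [tension_congr hW (fun x hx => by rw [huu' x hx]) hwW,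
    tension_eq_zero_of_quotHarmonicOn B hsq hW hu' hwW]

end harmonicComp

section surface

variable {A : Type*} [NormedRing A] {G : Subgroup Aˣ}

theorem mul_self_eq_one_of_conj_conj (hcenter : Subgroup.center G = ⊥) {h : G}
    (hh : ∀ g : G, MulAut.conj h (MulAut.conj h g) = g) : h * h = 1 := by
  have hmem : h * h ∈ Subgroup.center G := Subgroup.mem_center_iff.2 fun g => by
    have hg := hh g
    simp only [MulAut.conj_apply] at hg
    calc g * (h * h) = h * (h * g * h⁻¹) * h⁻¹ * (h * h) := by rw [hg]
      _ = h * h * g := by group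
  rwa [hcenter, Subgroup.mem_bot] at hmem

variable [NormedAlgebra ℝ A] [FiniteDimensional ℝ A] {B : BiinvariantMetric G} {h : G}
  {M : Type*} [TopologicalSpace M] [ChartedSpace ℂ M]

theorem mem_modifiedHarmonic (hsq : h * h = 1) {z₀ : M} {f : M → SymSpace h}
    (hf : f ∈ BasedHarmonic B h z₀) :
    (fun z => cartanEmbedding h (f z)) ∈ ModifiedHarmonic B h z₀ := by
  refine ⟨fun e he => ?_, fun z => (bijOn_cartanEmbedding h).mapsTo (mem_univ _),
    fun z => cartanEmbedding_mul_self hsq _, by simp [hf.2]⟩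
  exact (quotHarmonicOn_iff_harmonicOn B hsq e.open_target (hf.1 e he).smooth).1 (hf.1 e he)

theorem bijOn_basedHarmonic (B : BiinvariantMetric G) (hG : IsClosed (G : Set Aˣ))
    (hsq : h * h = 1) (z₀ : M) :
    BijOn (fun (f : M → SymSpace h) (z : M) => cartanEmbedding h (f z))
      (BasedHarmonic B h z₀) (ModifiedHarmonic B h z₀) := by
  refine ⟨fun f hf => mem_modifiedHarmonic hsq hf, fun f _ f' _ hff' =>
    funext fun z => cartanEmbedding_injective h (congrFun hff' z), ?_⟩
  rintro k ⟨hk, hkc, -, hk0⟩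
  choose f _ hf using fun z => (bijOn_cartanEmbedding h).surjOn (hkc z)
  refine ⟨f, ⟨fun e he => ?_, ?_⟩, funext hf⟩
  · have hH : HarmonicOn B (fun w => cartanEmbedding h (f (e.symm w))) e.target := by
      simpa only [hf] using hk e he
    exact quotHarmonicOn_of_harmonicOn B hsq e.open_target
      (quotSmoothOn_of_smoothOn hG hsq e.open_target hH.smooth) hH
  · apply cartanEmbedding_injective h
    rw [hf z₀, hk0, cartanEmbedding_mk]
    simp

theorem IsQuotHarmonic.comp [IsManifold 𝓘(ℂ) 1 M] {N : Type*} [TopologicalSpace N]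
    [ChartedSpace ℂ N] [IsManifold 𝓘(ℂ) 1 N] (hsq : h * h = 1) {f : M → SymSpace h}
    (hf : IsQuotHarmonic B f) {p : N → M} (hp : MDifferentiable 𝓘(ℂ) 𝓘(ℂ) p) :
    IsQuotHarmonic B (fun y => f (p y)) := by
  intro e he
  refine quotHarmonicOn_of_forall_exists hsq e.open_target fun w hw => ?_
  set c := chartAt ℂ (p (e.symm w))
  have hc : c ∈ atlas ℂ M := chart_mem_atlas ℂ _
  set W : Set ℂ := e.target ∩ e.symm ⁻¹' (p ⁻¹' c.source)
  have hW : IsOpen W := e.symm.isOpen_inter_preimage (c.open_source.preimage hp.continuous)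
  have hφ : DifferentiableOn ℂ (fun x => c (p (e.symm x))) W := by
    rw [← mdifferentiableOn_iff_differentiableOn]
    exact (mdifferentiableOn_atlas hc).comp (hp.comp_mdifferentiableOn
      ((mdifferentiableOn_atlas_symm he).mono inter_subset_left)) fun x hx => hx.2
  exact ⟨W, hW, ⟨hw, mem_chart_source ℂ (p (e.symm w))⟩, _,
    (hf c hc).comp hsq c.open_target hW hφ fun x hx => c.map_source hx.2,
    fun x hx => by rw [c.left_inv hx.2]⟩

theorem IsExtendedFrame.mk_mem_basedHarmonic (hsq : h * h = 1) {y₀ : M} {f : M → SymSpace h}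
    {F : Circle → M → G} (hF : IsExtendedFrame h y₀ f F) (hf : IsQuotHarmonic B f) (l : Circle) :
    (fun y => (F l y : SymSpace h)) ∈ BasedHarmonic B h y₀ := by
  refine ⟨fun e he => ?_, by simp only [hF.base l]⟩
  have hlift : IsLift (fun x => (F l (e.symm x) : SymSpace h)) (fun x => F l (e.symm x)) e.target :=
    ⟨hF.smooth l e he, fun _ _ => rfl⟩
  have hlift₁ : IsLift (fun x => f (e.symm x)) (fun x => F 1 (e.symm x)) e.target :=
    ⟨hF.smooth 1 e he, fun x _ => hF.lift (e.symm x)⟩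
  refine (quotHarmonicOn_iff_tension_eq_zero B hsq e.open_target
    fun w hw => ⟨e.target, e.open_target, hw, _, hlift⟩).2 fun w hw => ?_
  have hdiv := (tension_cartanEmbedding_eq_zero_iff hsq e.open_target hlift₁ hw).1
    (tension_eq_zero_of_quotHarmonicOn B hsq e.open_target (hf e he) hw)
  rw [tension_cartanEmbedding_eq_zero_iff hsq e.open_target hlift hw,
    covariantDivergence_frame hsq e.open_target hlift₁.1 hw fun x hx v =>
      eq_of_frame_equation (hF.equation l e he x hx v), hdiv, smul_zero]

end surface

end CartanHarmonic

end

theorem mainTheorem12_general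
    {A : Type*} [NormedRing A] [NormedAlgebra ℝ A] [FiniteDimensional ℝ A] {G : Subgroup Aˣ}
    (hG_closed : IsClosed (G : Set Aˣ)) {h : G} (hsq : h * h = 1)
    (B : CartanHarmonic.BiinvariantMetric G)
    {M : Type*} [TopologicalSpace M] [ChartedSpace ℂ M] [IsManifold 𝓘(ℂ) 1 M] (z₀ : M) :
    Set.BijOn (CartanHarmonic.cartanEmbedding h) Set.univ (CartanHarmonic.conjClass h) ∧
    Set.BijOn (fun (f : M → CartanHarmonic.SymSpace h) (z : M) =>
        CartanHarmonic.cartanEmbedding h (f z))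
      (CartanHarmonic.BasedHarmonic B h z₀) (CartanHarmonic.ModifiedHarmonic B h z₀) ∧
    ∀ {N : Type*} [TopologicalSpace N] [ChartedSpace ℂ N] [IsManifold 𝓘(ℂ) 1 N]
      (p : N → M), MDifferentiable 𝓘(ℂ) 𝓘(ℂ) p →
      ∀ (y₀ : N) (f : M → CartanHarmonic.SymSpace h), CartanHarmonic.IsQuotHarmonic B f →
      ∀ F : Circle → N → G, CartanHarmonic.IsExtendedFrame h y₀ (fun y => f (p y)) F →
      ∀ l : Circle,
        (fun y => (F l y : CartanHarmonic.SymSpace h)) ∈ CartanHarmonic.BasedHarmonic B h y₀ ∧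
        (fun y => F l y * h * (F l y)⁻¹) ∈ CartanHarmonic.ModifiedHarmonic B h y₀ ∧
        ∀ y, CartanHarmonic.cartanEmbedding h (F l y : CartanHarmonic.SymSpace h) =
          F l y * h * (F l y)⁻¹ := by
  refine ⟨CartanHarmonic.bijOn_cartanEmbedding h,
    CartanHarmonic.bijOn_basedHarmonic B hG_closed hsq z₀, ?_⟩
  intro N _ _ _ p hp y₀ f hf F hF l
  have hl := hF.mk_mem_basedHarmonic hsq (hf.comp hsq hp) l
  exact ⟨hl, CartanHarmonic.mem_modifiedHarmonic hsq hl,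
    fun y => CartanHarmonic.cartanEmbedding_mk h (F l y)⟩

theorem mainTheorem12
    {V : Type*} [NormedAddCommGroup V] [NormedSpace ℝ V] [FiniteDimensional ℝ V]
    -- `G` is a connected semisimple linear Lie group with trivial center
    (G : Subgroup (V →L[ℝ] V)ˣ)
    (hG_closed : IsClosed (G : Set (V →L[ℝ] V)ˣ))
    (hG_connected : IsConnected (G : Set (V →L[ℝ] V)ˣ))
    (hG_semisimple : LieAlgebra.IsSemisimple ℝ (CartanHarmonic.lieAlg G))
    (hG_center : Subgroup.center G = ⊥)
    -- `g ↦ h g h⁻¹` is an involution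
    (h : G) (hh : ∀ g : G, MulAut.conj h (MulAut.conj h g) = g)
    (B : CartanHarmonic.BiinvariantMetric G)
    -- `M` is a connected Riemann surface
    {M : Type*} [TopologicalSpace M] [T2Space M] [ConnectedSpace M] [ChartedSpace ℂ M]
    [IsManifold (modelWithCornersSelf ℂ ℂ) (⊤ : WithTop ℕ∞) M] (z₀ : M) :
    -- the modified Cartan embedding is a bijection of `G / K` onto the conjugacy class of `h`
    Set.BijOn (CartanHarmonic.cartanEmbedding h) Set.univ (CartanHarmonic.conjClass h) ∧
    -- composition with it is the asserted bijection
    Set.BijOn (fun (f : M → CartanHarmonic.SymSpace h) (z : M) =>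
        CartanHarmonic.cartanEmbedding h (f z))
      (CartanHarmonic.BasedHarmonic B h z₀) (CartanHarmonic.ModifiedHarmonic B h z₀) ∧
    -- the same for all members of the associated family, on the universal covering `p : N → M`
    ∀ {N : Type*} [TopologicalSpace N] [T2Space N] [SimplyConnectedSpace N] [ChartedSpace ℂ N]
      [IsManifold (modelWithCornersSelf ℂ ℂ) (⊤ : WithTop ℕ∞) N]
      (p : N → M), IsCoveringMap p →
      MDifferentiable (modelWithCornersSelf ℂ ℂ) (modelWithCornersSelf ℂ ℂ) p →
      ∀ y₀ : N, p y₀ = z₀ →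
      ∀ f ∈ CartanHarmonic.BasedHarmonic B h z₀, ∀ F : Circle → N → G,
      CartanHarmonic.IsExtendedFrame h y₀ (fun y => f (p y)) F →
      ∀ l : Circle,
        (fun y => (F l y : CartanHarmonic.SymSpace h)) ∈ CartanHarmonic.BasedHarmonic B h y₀ ∧
        (fun y => F l y * h * (F l y)⁻¹) ∈ CartanHarmonic.ModifiedHarmonic B h y₀ ∧
        ∀ y, CartanHarmonic.cartanEmbedding h (F l y : CartanHarmonic.SymSpace h) =
          F l y * h * (F l y)⁻¹ := by
  have hM : IsManifold 𝓘(ℂ) 1 M := IsManifold.of_le (n := ⊤) le_top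
  obtain ⟨hK, hbij, hfamily⟩ := mainTheorem12_general hG_closed
    (CartanHarmonic.mul_self_eq_one_of_conj_conj hG_center hh) B z₀
  refine ⟨hK, hbij, fun {N} _ _ _ _ _ p _ hp y₀ _ f hf F hF l => ?_⟩
  have hN : IsManifold 𝓘(ℂ) 1 N := IsManifold.of_le (n := ⊤) le_top
  exact hfamily p hp y₀ f hf.1 F hF l
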